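/- Let $D$ be an unoriented link diagram in the disc (or on the sphere) with linearly ordered crossings, and let $\mathcal R$ be any ring with unit. A Kauffman state of $D$ assigns a marker $\pm1$ to each crossing. The positive marker smooths the crossing by opening the channel between the two regions swept when the upper strand is turned counterclockwise; the negative marker gives the other smoothing. An enhanced state $S$ is a Kauffman state together with a sign $\pm$ for each circle of the smoothed diagram $D_S$. Let $\sigma(S)$ be the number of positive minus the number of negative markers, and $\tau(S)$ the number of positive minus the number of negative circles. Let $C_{i,j}(D;\mathcal R)$ be the free $\mathcal R$-module on the enhanced states with $\sigma(S)=i$ and $\sigma(S)+2\tau(S)=j$. The differential $d_{i,j}\colon C_{i,j}\to C_{i-2,j}$ is $d(S)=\sum_{S'}(-1)^{t(S:S')}[S:S']\,S'$, where $[S:S']=1$ if the markers of $S$ and $S'$ differ at exactly one crossing $c$ and all circles not touching $c$ have the same sign in $S$ and $S'$, and $[S:S']=0$ otherwise; $t(S:S')$ is the number of negative markers of $S$ at crossings bigger than $c$. The Khovanov homology is $H_{i,j}(D;\mathcal R)=\ker d_{i,j}/d_{i+2,j}(C_{i+2,j}(D;\mathcal R))$. Let $D_h$ be the standard two-crossing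 diagram of the Hopf link, and let $D\#D_h$ be a connected sum of $D$ and $D_h$ along any arc of $D$ and any arc of $D_h$ (with the arcs joined in either of the two ways), with the crossings of $D_h$ placed after those of $D$. If both crossings of $D_h$ get the same marker, the circles of the smoothed diagram $D\#D_h$ are those of the smoothed diagram $D$ and one new circle, which does not meet $D$. Let $\alpha_h\colon C_{i+2,j+4}(D;\mathcal R)\to C_{i,j}(D\#D_h;\mathcal R)$ send an enhanced state $S$ to the state obtained from $S$ by giving both crossings of $D_h$ negative markers and the new circle the sign $-$. Let $\beta_h\colon C_{i,j}(D\#D_h;\mathcal R)\to C_{i-2,j-4}(D;\mathcal R)$ send a state with positive markers at both crossings of $D_h$ and the sign $+$ on the new circle to the underlying enhanced state of $D$, and every other state to $0$. Then for all $i,j\in\mathbb Z$ the maps $\alpha_h$ and $\beta_h$ send cycles to cycles and induce $\mathcal R$-linear maps on homology that form a short exact sequence $$0\to H_{i+2,j+4}(D;\mathcal R)\xrightarrow{\ \alpha_h\ }H_{i,j}(D\#D_h;\mathcal R)\xrightarrow{\ \beta_h\ }H_{i-2,j-4}(D;\mathcal R)\to0 .$$ This sequence splits, that is, there is an $\mathcal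 R$-linear isomorphism $$H_{i,j}(D\#D_h;\mathcal R)\cong H_{i+2,j+4}(D;\mathcal R)\oplus H_{i-2,j-4}(D;\mathcal R)$$ which carries $\alpha_h$ to the inclusion of the first summand and $\beta_h$ to the projection onto the second. -/

import Mathlib

/-- The darts (edge ends) of a link diagram with set of crossings `C` and set of marked points `P`.
Each crossing `c` has four darts `(c, 0), (c, 1), (c, 2), (c, 3)`, in counterclockwise order, where
`(c, 0), (c, 2)` belong to the lower strand and `(c, 1), (c, 3)` to the upper strand. A marked point
is a 2-valent point on the link; such points make it possible to have components without
crossings. -/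
abbrev Dart (C P : Type*) : Type _ := (C × Fin 4) ⊕ (P × Fin 2)

/-- A combinatorial (unoriented) link diagram: the darts are glued in pairs, and each pair is an arc
of the diagram. It is a diagram on the sphere (equivalently, on a disc) when it is planar in the
sense of `LinkDiagram.IsPlanar`. -/
structure LinkDiagram (C P : Type*) where
  glue : Dart C P → Dart C P
  glue_glue : ∀ x, glue (glue x) = x
  glue_ne : ∀ x, glue x ≠ x

namespace LinkDiagram

section Basic

variable {C P : Type*} (D : LinkDiagram C P)

/-- The counterclockwise rotation of the darts around each crossing and each marked point. -/
def rotate : Dart C P → Dart C P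
  | Sum.inl (c, k) => Sum.inl (c, k + 1)
  | Sum.inr (p, k) => Sum.inr (p, k + 1)

/-- The arcs of the diagram. -/
def Arc : Type _ := Quot fun x y : Dart C P => y = D.glue x

/-- The faces (the boundary walks of the regions) of the underlying ribbon graph. -/
def Face : Type _ := Quot fun x y : Dart C P => y = rotate (D.glue x)

/-- The connected components of the underlying graph. -/
def Component : Type _ := Quot fun x y : Dart C P => y = D.glue x ∨ y = rotate x

/-- Planarity by Euler's formula `V - E + F = 2 K`: each connected component of the underlying
ribbon graph has genus zero. -/
def IsPlanar : Prop :=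
  (Nat.card (C ⊕ P) : ℤ) - Nat.card D.Arc + Nat.card D.Face = 2 * Nat.card D.Component

/-- How a marker joins the four darts of a crossing: the positive marker opens the channel between
the two regions that are swept by turning the upper strand counterclockwise, so it joins
`0` to `1` and `2` to `3`; the negative marker joins `0` to `3` and `1` to `2`. -/
def turn (ε : ℤˣ) (k : Fin 4) : Fin 4 :=
  if ε = 1 then ![1, 0, 3, 2] k else ![3, 2, 1, 0] k

/-- The smoothing of all crossings according to the markers of a Kauffman state `s`. -/
def smoothing (s : C → ℤˣ) : Dart C P → Dart C P
  | Sum.inl (c, k) => Sum.inl (c, turn (s c) k)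
  | Sum.inr (p, k) => Sum.inr (p, k + 1)

/-- The circles of `D_s`. -/
def Circle (s : C → ℤˣ) : Type _ :=
  Quot fun x y : Dart C P => y = D.glue x ∨ y = smoothing s x

instance [Finite C] [Finite P] (s : C → ℤˣ) : Finite (D.Circle s) :=
  inferInstanceAs (Finite (Quot _))

noncomputable instance [Finite C] [Finite P] (s : C → ℤˣ) : Fintype (D.Circle s) :=
  Fintype.ofFinite _

/-- An enhanced Kauffman state: a marker for each crossing and a sign for each circle. -/
structure EnhState where
  marker : C → ℤˣ
  sign : D.Circle marker → ℤˣ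

instance [Finite C] [Finite P] : Finite D.EnhState :=
  Finite.of_injective
    (fun S : D.EnhState => (⟨S.marker, S.sign⟩ : Σ s : C → ℤˣ, D.Circle s → ℤˣ))
    (by rintro ⟨s, f⟩ ⟨s', f'⟩ h; cases h; rfl)

noncomputable instance [Finite C] [Finite P] : Fintype D.EnhState := Fintype.ofFinite _

variable {D}

/-- The circle of `D_S` through the dart `x`. -/
def EnhState.circle (S : D.EnhState) (x : Dart C P) : D.Circle S.marker := Quot.mk _ x

/-- `σ(S)`: the number of positive markers minus the number of negative markers. -/
def EnhState.sigma [Fintype C] (S : D.EnhState) : ℤ := ∑ c, (S.marker c : ℤ)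

/-- `τ(S)`: the number of positive circles minus the number of negative circles. -/
noncomputable def EnhState.tau [Finite C] [Finite P] (S : D.EnhState) : ℤ :=
  ∑ z : D.Circle S.marker, (S.sign z : ℤ)

/-- The second grading `σ(S) + 2 τ(S)`. -/
noncomputable def EnhState.weight [Fintype C] [Finite P] (S : D.EnhState) : ℤ :=
  S.sigma + 2 * S.tau

/-- `[S : S'] = 1`, where `c` is the crossing at which the markers differ: the markers of `S` and
`S'` differ exactly at `c`, the bidegree drops by `(2, 0)`, and all the circles that do not touch `c`
have the same sign in `S` and in `S'`. -/
def EnhState.Incident [Fintype C] [Finite P] (c : C) (S S' : D.EnhState) : Prop :=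
  (∀ c', S.marker c' ≠ S'.marker c' ↔ c' = c) ∧
  S'.sigma = S.sigma - 2 ∧ S'.weight = S.weight ∧
  ∀ x : Dart C P, (∀ k : Fin 4, S.circle (Sum.inl (c, k)) ≠ S.circle x) →
    S'.sign (S'.circle x) = S.sign (S.circle x)

/-- The number of negative markers of `S` at the crossings bigger than `c`. -/
def EnhState.negAfter [Fintype C] [LinearOrder C] (S : D.EnhState) (c : C) : ℕ :=
  (Finset.univ.filter fun c' => c < c' ∧ S.marker c' = -1).card

end Basic

section Homology

variable {C P : Type*} [Fintype C] [LinearOrder C] [Finite P]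
variable (D : LinkDiagram C P) (R : Type*) [Ring R]

/-- The free `R`-module on the (finitely many) enhanced states: the state `S` is the function
`Pi.single S 1`. -/
abbrev Chains : Type _ := D.EnhState → R

/-- The bigraded piece spanned by the enhanced states with `σ = i` and `σ + 2 τ = j`. -/
def chains (i j : ℤ) : Submodule R (D.Chains R) where
  carrier := {f | ∀ S, ¬(S.sigma = i ∧ S.weight = j) → f S = 0}
  add_mem' hf hg S hS := by simp [hf S hS, hg S hS]
  zero_mem' _ _ := rfl
  smul_mem' r f hf S hS := by simp [hf S hS]

open scoped Classical in
/-- The differential `d(S) = ∑ (-1)^{t(S:S')} [S:S'] S'`, of bidegree `(-2, 0)`. -/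
noncomputable def d : D.Chains R →ₗ[R] D.Chains R :=
  Fintype.linearCombination R fun S : D.EnhState =>
    ∑ c : C, ∑ S' : D.EnhState,
      if EnhState.Incident c S S' then Pi.single S' ((-1 : R) ^ S.negAfter c) else 0

/-- The kernel of `d_{i,j}`. -/
noncomputable def cycles (i j : ℤ) : Submodule R (D.Chains R) :=
  LinearMap.ker (D.d R) ⊓ D.chains R i j

/-- The image `d_{i+2,j}(C_{i+2,j})`. -/
noncomputable def boundaries (i j : ℤ) : Submodule R (D.Chains R) :=
  (D.chains R (i + 2) j).map (D.d R)

/-- The Khovanov homology `H_{i,j}(D; R) = ker d_{i,j} / d_{i+2,j}(C_{i+2,j})`. -/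
abbrev Homology (i j : ℤ) : Type _ :=
  D.cycles R i j ⧸ (D.boundaries R i j).submoduleOf (D.cycles R i j)

/-- The homology class of a cycle. -/
noncomputable def homologyClass (i j : ℤ) : D.cycles R i j →ₗ[R] D.Homology R i j :=
  ((D.boundaries R i j).submoduleOf (D.cycles R i j)).mkQ

end Homology

section ConnectedSum

variable {C₁ P₁ C₂ P₂ : Type*}

/-- The darts of two diagrams together, as the darts of one diagram. The crossings of the first
diagram come before those of the second one. -/
def dartEquiv (C₁ P₁ C₂ P₂ : Type*) :
    Dart C₁ P₁ ⊕ Dart C₂ P₂ ≃ Dart (C₁ ⊕ₗ C₂) (P₁ ⊕ P₂) where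
  toFun
    | Sum.inl (Sum.inl (c, k)) => Sum.inl (toLex (Sum.inl c), k)
    | Sum.inl (Sum.inr (p, k)) => Sum.inr (Sum.inl p, k)
    | Sum.inr (Sum.inl (c, k)) => Sum.inl (toLex (Sum.inr c), k)
    | Sum.inr (Sum.inr (p, k)) => Sum.inr (Sum.inr p, k)
  invFun
    | Sum.inl (c, k) => Sum.map (fun c => Sum.inl (c, k)) (fun c => Sum.inl (c, k)) (ofLex c)
    | Sum.inr (p, k) => Sum.map (fun p => Sum.inr (p, k)) (fun p => Sum.inr (p, k)) p
  left_inv := by rintro ((⟨c, k⟩ | ⟨p, k⟩) | (⟨c, k⟩ | ⟨p, k⟩)) <;> rfl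
  right_inv := by rintro (⟨(c | c), k⟩ | ⟨(p | p), k⟩) <;> rfl

open scoped Classical in
/-- The gluing of the connected sum: the arc `{a, glue a}` of `D₁` and the arc `{b, glue b}` of `D₂`
are cut, and `a` is joined to `b` and `glue a` to `glue b`. -/
noncomputable def sumGlue (D₁ : LinkDiagram C₁ P₁) (a : Dart C₁ P₁)
    (D₂ : LinkDiagram C₂ P₂) (b : Dart C₂ P₂) :
    Dart C₁ P₁ ⊕ Dart C₂ P₂ → Dart C₁ P₁ ⊕ Dart C₂ P₂
  | Sum.inl x =>
      if x = a then Sum.inr b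
      else if x = D₁.glue a then Sum.inr (D₂.glue b)
      else Sum.inl (D₁.glue x)
  | Sum.inr y =>
      if y = b then Sum.inl a
      else if y = D₂.glue b then Sum.inl (D₁.glue a)
      else Sum.inr (D₂.glue y)

theorem sumGlue_sumGlue (D₁ : LinkDiagram C₁ P₁) (a : Dart C₁ P₁)
    (D₂ : LinkDiagram C₂ P₂) (b : Dart C₂ P₂) (x : Dart C₁ P₁ ⊕ Dart C₂ P₂) :
    sumGlue D₁ a D₂ b (sumGlue D₁ a D₂ b x) = x := by
  have ha := D₁.glue_ne a
  have hb := D₂.glue_ne b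
  rcases x with x | x
  · have h1 := D₁.glue_glue x
    have h2 := D₁.glue_glue a
    simp only [sumGlue]
    split_ifs <;> simp_all
    split_ifs <;> simp_all
  · have h1 := D₂.glue_glue x
    have h2 := D₂.glue_glue b
    simp only [sumGlue]
    split_ifs <;> simp_all
    split_ifs <;> simp_all

theorem sumGlue_ne (D₁ : LinkDiagram C₁ P₁) (a : Dart C₁ P₁)
    (D₂ : LinkDiagram C₂ P₂) (b : Dart C₂ P₂) (x : Dart C₁ P₁ ⊕ Dart C₂ P₂) :
    sumGlue D₁ a D₂ b x ≠ x := by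
  rcases x with x | x
  · have h1 := D₁.glue_ne x
    simp only [sumGlue]
    split_ifs <;> simp_all
  · have h1 := D₂.glue_ne x
    simp only [sumGlue]
    split_ifs <;> simp_all

/-- The connected sum `D₁ # D₂` along the arcs of the darts `a` and `b`. Replacing `b` by
`D₂.glue b` gives the other way of joining the same two arcs. -/
noncomputable def connectedSum (D₁ : LinkDiagram C₁ P₁) (a : Dart C₁ P₁)
    (D₂ : LinkDiagram C₂ P₂) (b : Dart C₂ P₂) : LinkDiagram (C₁ ⊕ₗ C₂) (P₁ ⊕ P₂) where
  glue x := dartEquiv C₁ P₁ C₂ P₂ (sumGlue D₁ a D₂ b ((dartEquiv C₁ P₁ C₂ P₂).symm x))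
  glue_glue x := by simp [sumGlue_sumGlue]
  glue_ne x h := by
    apply sumGlue_ne D₁ a D₂ b ((dartEquiv C₁ P₁ C₂ P₂).symm x)
    rw [Equiv.eq_symm_apply, h]

/-- The standard two-crossing diagram of the Hopf link: the dart `k` of each crossing is glued to the
dart `3 - k` of the other crossing. -/
def hopf : LinkDiagram (Fin 2) Empty where
  glue
    | Sum.inl (c, k) => Sum.inl (c.rev, k.rev)
    | Sum.inr (p, _) => p.elim
  glue_glue := by
    rintro (⟨c, k⟩ | ⟨p, k⟩)
    · simp
    · exact p.elim
  glue_ne := by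
    rintro (⟨c, k⟩ | ⟨p, k⟩)
    · fin_cases c <;> simp [Fin.rev]
    · exact p.elim

end ConnectedSum

section HopfSum

variable {C P : Type*} (D : LinkDiagram C P) (a : Dart C P) (b : Dart (Fin 2) Empty)

/-- The connected sum of `D` with the two-crossing diagram of the Hopf link. -/
noncomputable abbrev hopfSum : LinkDiagram (C ⊕ₗ Fin 2) (P ⊕ Empty) :=
  D.connectedSum a hopf b

variable {D a b}

/-- The enhanced state `S'` of `D # D_h` is the enhanced state `S` of `D` together with two markers
`ε` at the crossings of `D_h` and the sign `ε` on the new circle: `S'` has the markers of `S` at the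
crossings of `D`, each circle of `S'` that runs through `D` has the sign of the corresponding
circle of `S`, and the circle of `S'` that does not meet `D` has the sign `ε`. -/
def HopfExtends (ε : ℤˣ) (S : D.EnhState) (S' : (D.hopfSum a b).EnhState) : Prop :=
  (∀ c : C, S'.marker (toLex (Sum.inl c)) = S.marker c) ∧
  (∀ e : Fin 2, S'.marker (toLex (Sum.inr e)) = ε) ∧
  (∀ x : Dart C P,
    S'.sign (S'.circle (dartEquiv C P (Fin 2) Empty (Sum.inl x))) = S.sign (S.circle x)) ∧
  (∀ z : (D.hopfSum a b).Circle S'.marker,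
    (∀ x : Dart C P, S'.circle (dartEquiv C P (Fin 2) Empty (Sum.inl x)) ≠ z) → S'.sign z = ε)

variable [Fintype C] [LinearOrder C] [Finite P] (D a b) (R : Type*) [Ring R]

open scoped Classical in
/-- The map `α_h` on chains: it sends a state `S` to the state with two negative markers at the
crossings of `D_h` and a negative new circle. -/
noncomputable def alphaH : D.Chains R →ₗ[R] (D.hopfSum a b).Chains R :=
  Fintype.linearCombination R fun S : D.EnhState =>
    ∑ S' : (D.hopfSum a b).EnhState, if HopfExtends (-1) S S' then Pi.single S' 1 else 0

open scoped Classical in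
/-- The map `β_h` on chains: it sends the state with two positive markers at the crossings of `D_h`
and a positive new circle to the underlying state of `D`, and all the other states to `0`. -/
noncomputable def betaH : (D.hopfSum a b).Chains R →ₗ[R] D.Chains R :=
  Fintype.linearCombination R fun S' : (D.hopfSum a b).EnhState =>
    ∑ S : D.EnhState, if HopfExtends 1 S S' then Pi.single S 1 else 0

end HopfSum

end LinkDiagram

/-!
The chains of `D` form a module over `A = R[x]/x²`, where the sign `-` of a circle stands for `1`,
the sign `+` for `x`, and `A` acts through the circle at the dart `a`; the action of `x` is `raise`,
and it commutes with the differential (`d_raise`). The complex of `D # D_h` is obtained from that of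
`D` by tensoring over `A` with the complex of the Hopf diagram based at `b`,
`A ⊗ A → A ⊕ A → A ⊗ A`, whose maps are, up to signs, the multiplication `m` into both summands and
the comultiplication `Δ` out of both summands. It is exact in the middle, `ker m` is the free
`A`-module on `1 ⊗ x - x ⊗ 1`, and `coker Δ` is the free `A`-module on the class of `1 ⊗ 1`. Thus
the homology is a sum of two shifted copies of the homology of `D`; `α_h` is the map `u ↦ u ⊗ 1`
into the last term, and `β_h` reads off the coefficient of `1 ⊗ x` in the first term.

Concretely, `joinEquiv` identifies the enhanced states of `D # D_h` with pairs of an enhanced state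
of `D` and one of six local states, and `incident_joinState_inl`, `incident_joinState_inr` describe
the incidence numbers, so that the differential has explicit components (`splitChains_d_apply`). The
section `betaSection` of `β_h` and the retraction `alphaRetraction` of `α_h` are chain maps by
`d_raise`, and `hopfHomotopy` contracts what is left (`hopfHomotopy_spec`). On homology the
retraction together with `β_h` is the required isomorphism.

That `raise` is a chain map rests on a count: at a crossing there are one or two circles before and
after the change of a marker, and their total sign goes up by `1`, which forces their signs if one
of them is positive before the change (`EnhState.Incident.sign_eq_one`).
-/

namespace LinkDiagram

/-! ### Circles and enhanced states -/

section Circles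

variable {C P : Type*} {D : LinkDiagram C P}

theorem EnhState.circle_glue (S : D.EnhState) (x : Dart C P) :
    S.circle (D.glue x) = S.circle x :=
  Eq.symm (Quot.sound (r := fun x y => y = D.glue x ∨ y = smoothing S.marker x) (Or.inl rfl))

theorem EnhState.circle_smoothing (S : D.EnhState) (x : Dart C P) :
    S.circle (smoothing S.marker x) = S.circle x :=
  Eq.symm (Quot.sound (r := fun x y => y = D.glue x ∨ y = smoothing S.marker x) (Or.inr rfl))

/-- A function on the darts that is invariant under the gluing and the smoothing is constant on
circles. -/
theorem EnhState.eq_of_circle_eq (S : D.EnhState) {α : Sort*} (f : Dart C P → α)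
    (hg : ∀ x, f (D.glue x) = f x) (hs : ∀ x, f (smoothing S.marker x) = f x) {x y : Dart C P}
    (h : S.circle x = S.circle y) : f x = f y :=
  congrArg (Quot.lift f (by rintro x y (rfl | rfl); exacts [(hg x).symm, (hs x).symm])) h

theorem EnhState.ext_sign {S S' : D.EnhState} (hm : S.marker = S'.marker)
    (hs : ∀ x, S.sign (S.circle x) = S'.sign (S'.circle x)) : S = S' := by
  rcases S with ⟨s, f⟩
  rcases S' with ⟨s', f'⟩
  obtain rfl : s = s' := hm
  congr
  funext z
  induction z using Quot.ind
  exact hs _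

theorem EnhState.circle_eq_zero_or_two (S : D.EnhState) (c : C) (k : Fin 4) :
    S.circle (Sum.inl (c, k)) = S.circle (Sum.inl (c, 0)) ∨
      S.circle (Sum.inl (c, k)) = S.circle (Sum.inl (c, 2)) := by
  have h0 := S.circle_smoothing (Sum.inl (c, 0))
  have h2 := S.circle_smoothing (Sum.inl (c, 2))
  simp only [smoothing, turn] at h0 h2
  split_ifs at h0 h2 <;> fin_cases k <;> simp_all

/-- If two states have the same markers except at `c`, then a circle that does not touch `c` is not
enlarged by the change of the marker. -/
theorem EnhState.circle_eq_of_not_touching {S S' : D.EnhState} {c : C}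
    (hm : ∀ c', S.marker c' ≠ S'.marker c' → c' = c) {x y : Dart C P}
    (hx : ∀ k : Fin 4, S.circle (Sum.inl (c, k)) ≠ S.circle x)
    (h : S'.circle y = S'.circle x) : S.circle y = S.circle x := by
  -- Lying on the circle of `S` through `x` is invariant under the smoothing of `S'` too, since no
  -- dart at `c` has this property.
  refine (S'.eq_of_circle_eq (fun y => S.circle y = S.circle x) ?_ ?_ h).mpr rfl
  · intro y
    simp only [S.circle_glue]
  · rintro (⟨c', k⟩ | ⟨p, k⟩)
    · by_cases hc : c' = c
      · subst hc
        exact propext ⟨fun h => (hx _ h).elim, fun h => (hx _ h).elim⟩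
      · have : S.marker c' = S'.marker c' := by_contra fun h => hc (hm _ h)
        rw [show smoothing S'.marker (Sum.inl (c', k) : Dart C P)
          = smoothing S.marker (Sum.inl (c', k)) by simp [smoothing, this], S.circle_smoothing]
    · have h := S.circle_smoothing (Sum.inr (p, k))
      simp only [smoothing] at h ⊢
      rw [h]

theorem EnhState.not_touching_of_not_touching {S S' : D.EnhState} {c : C}
    (hm : ∀ c', S.marker c' ≠ S'.marker c' → c' = c) {x : Dart C P}
    (hx : ∀ k : Fin 4, S.circle (Sum.inl (c, k)) ≠ S.circle x) (k : Fin 4) :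
    S'.circle (Sum.inl (c, k)) ≠ S'.circle x :=
  fun h => hx k (circle_eq_of_not_touching hm hx h)

theorem EnhState.circle_eq_iff_of_not_touching {S S' : D.EnhState} {c : C}
    (hm : ∀ c', S.marker c' ≠ S'.marker c' → c' = c) {x : Dart C P}
    (hx : ∀ k : Fin 4, S.circle (Sum.inl (c, k)) ≠ S.circle x) (y : Dart C P) :
    S'.circle y = S'.circle x ↔ S.circle y = S.circle x :=
  ⟨circle_eq_of_not_touching hm hx, circle_eq_of_not_touching (fun c' h => hm c' h.symm)
    (not_touching_of_not_touching hm hx)⟩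

open scoped Classical in
/-- The total sign of the circles that do not touch the crossing `c`. -/
noncomputable def EnhState.tauAway [Finite C] [Finite P] (S : D.EnhState) (c : C) : ℤ :=
  ∑ z : D.Circle S.marker with ∀ k : Fin 4, S.circle (Sum.inl (c, k)) ≠ z, (S.sign z : ℤ)

open scoped Classical in
/-- `τ` is the total sign of the one or two circles at `c` plus that of the other circles. -/
theorem EnhState.tau_eq [Finite C] [Finite P] (S : D.EnhState) (c : C) :
    S.tau = (if S.circle (Sum.inl (c, 0)) = S.circle (Sum.inl (c, 2)) then
        (S.sign (S.circle (Sum.inl (c, 0))) : ℤ)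
      else (S.sign (S.circle (Sum.inl (c, 0))) : ℤ) + S.sign (S.circle (Sum.inl (c, 2))))
      + S.tauAway c := by
  have key : (Finset.univ.filter fun z : D.Circle S.marker =>
      ¬ ∀ k : Fin 4, S.circle (Sum.inl (c, k)) ≠ z) =
      {S.circle (Sum.inl (c, 0)), S.circle (Sum.inl (c, 2))} := by
    ext z
    simp only [Finset.mem_filter, Finset.mem_univ, true_and, not_forall, not_not,
      Finset.mem_insert, Finset.mem_singleton]
    constructor
    · rintro ⟨k, rfl⟩
      exact S.circle_eq_zero_or_two c k
    · rintro (rfl | rfl)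
      exacts [⟨0, rfl⟩, ⟨2, rfl⟩]
  rw [tau, tauAway, ← Finset.sum_filter_not_add_sum_filter _
    fun z : D.Circle S.marker => ∀ k : Fin 4, S.circle (Sum.inl (c, k)) ≠ z, key]
  congr 1
  split_ifs with h
  · simp [h]
  · rw [Finset.sum_pair h]

/-- The circles that do not touch `c` are not affected by a change of the marker at `c`. -/
theorem EnhState.tauAway_eq [Finite C] [Finite P] {S S' : D.EnhState} {c : C}
    (hm : ∀ c', S.marker c' ≠ S'.marker c' → c' = c)
    (hs : ∀ x : Dart C P, (∀ k : Fin 4, S.circle (Sum.inl (c, k)) ≠ S.circle x) →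
      S'.sign (S'.circle x) = S.sign (S.circle x)) : S'.tauAway c = S.tauAway c := by
  classical
  have hm' : ∀ c', S'.marker c' ≠ S.marker c' → c' = c := fun c' h => hm c' h.symm
  have out (T : D.EnhState) (z : D.Circle T.marker) : T.circle (Quot.out z) = z := Quot.out_eq z
  symm
  refine Finset.sum_bij (fun z _ => S'.circle (Quot.out z)) ?_ ?_ ?_ ?_
  · intro z hz
    simp only [Finset.mem_filter, Finset.mem_univ, true_and] at hz ⊢
    rw [← out S z] at hz
    exact not_touching_of_not_touching hm hz
  · intro z hz w hw h
    simp only [Finset.mem_filter, Finset.mem_univ, true_and] at hz hw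
    rw [← out S w] at hw
    have := circle_eq_of_not_touching hm hw h
    rwa [out, out] at this
  · intro z hz
    simp only [Finset.mem_filter, Finset.mem_univ, true_and] at hz
    rw [← out S' z] at hz
    have h2 := not_touching_of_not_touching hm' hz
    refine ⟨S.circle (Quot.out z), by simpa using h2, ?_⟩
    conv_rhs => rw [← out S' z]
    exact circle_eq_of_not_touching hm' hz (out S _)
  · intro z hz
    simp only [Finset.mem_filter, Finset.mem_univ, true_and] at hz
    rw [← out S z] at hz
    rw [hs _ hz, out]

variable [Fintype C] [Finite P]

/-- If one of the circles of `S` at `c` is positive and `S'` is incident to `S` at `c`, then all the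
circles of `S'` at `c` are positive. There are one or two circles at `c` before and after the change
of the marker, and their total sign goes up by `1`. -/
theorem EnhState.Incident.sign_eq_one {S S' : D.EnhState} {c : C} (h : Incident c S S')
    {k : Fin 4} (hk : S.sign (S.circle (Sum.inl (c, k))) = 1) (l : Fin 4) :
    S'.sign (S'.circle (Sum.inl (c, l))) = 1 := by
  classical
  obtain ⟨hm, hσ, hw, hs⟩ := h
  have h1 := S.tau_eq c
  have h2 := S'.tau_eq c
  rw [tauAway_eq (fun c' => (hm c').1) hs] at h2
  have h3 : S'.tau = S.tau + 1 := by
    unfold weight at hw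
    omega
  have hk' : S.sign (S.circle (Sum.inl (c, 0))) = 1 ∨ S.sign (S.circle (Sum.inl (c, 2))) = 1 := by
    rcases S.circle_eq_zero_or_two c k with h | h <;> rw [h] at hk <;> simp [hk]
  have hl : S'.sign (S'.circle (Sum.inl (c, 0))) = 1 ∧
      S'.sign (S'.circle (Sum.inl (c, 2))) = 1 := by
    have e1 : S.circle (Sum.inl (c, 0)) = S.circle (Sum.inl (c, 2)) →
      S.sign (S.circle (Sum.inl (c, 0))) = S.sign (S.circle (Sum.inl (c, 2))) := congrArg _
    have e2 : S'.circle (Sum.inl (c, 0)) = S'.circle (Sum.inl (c, 2)) →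
      S'.sign (S'.circle (Sum.inl (c, 0))) = S'.sign (S'.circle (Sum.inl (c, 2))) := congrArg _
    rcases Int.units_eq_one_or (S.sign (S.circle (Sum.inl (c, 0)))) with u0 | u0 <;>
    rcases Int.units_eq_one_or (S.sign (S.circle (Sum.inl (c, 2)))) with u2 | u2 <;>
    rcases Int.units_eq_one_or (S'.sign (S'.circle (Sum.inl (c, 0)))) with v0 | v0 <;>
    rcases Int.units_eq_one_or (S'.sign (S'.circle (Sum.inl (c, 2)))) with v2 | v2 <;>
    simp only [u0, u2, v0, v2] at h1 h2 hk' e1 e2 ⊢ <;>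
    split_ifs at h1 h2 with c1 c2 c2 <;>
    simp only [c1, c2, true_implies, false_implies, Units.val_one, Units.val_neg] at h1 h2 e1 e2 <;>
    first
    | exact ⟨trivial, trivial⟩
    | exact absurd e1 (by decide)
    | exact absurd e2 (by decide)
    | exact absurd hk' (by decide)
    | omega
  rcases S'.circle_eq_zero_or_two c l with h | h <;> rw [h]
  exacts [hl.1, hl.2]

end Circles

/-! ### The action of the nilpotent generator at a dart -/

section Flip

variable {C P : Type*} {D : LinkDiagram C P}

open scoped Classical in
/-- The enhanced state with the opposite sign on the circle through the dart `a`. -/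
noncomputable def EnhState.flip (a : Dart C P) (S : D.EnhState) : D.EnhState where
  marker := S.marker
  sign z := if z = S.circle a then -S.sign z else S.sign z

variable {a : Dart C P}

open scoped Classical in
theorem EnhState.sign_flip (S : D.EnhState) (x : Dart C P) :
    (S.flip a).sign ((S.flip a).circle x) =
      if S.circle x = S.circle a then -S.sign (S.circle x) else S.sign (S.circle x) :=
  rfl

theorem EnhState.sign_flip_self (S : D.EnhState) :
    (S.flip a).sign ((S.flip a).circle a) = -S.sign (S.circle a) := by
  simp [sign_flip]

theorem EnhState.flip_flip (S : D.EnhState) : (S.flip a).flip a = S := by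
  refine ext_sign rfl fun x => ?_
  have h : ∀ x y, (S.flip a).circle x = (S.flip a).circle y ↔ S.circle x = S.circle y :=
    fun x y => Iff.rfl
  by_cases hx : S.circle x = S.circle a <;> simp [sign_flip, hx, h]

/-- Two states that differ at most in the sign of the circle through `a` are equal or are
obtained from each other by `EnhState.flip`. -/
theorem EnhState.eq_or_eq_flip {S S' : D.EnhState} (hm : S.marker = S'.marker)
    (hs : ∀ x, S.circle x ≠ S.circle a → S'.sign (S'.circle x) = S.sign (S.circle x)) :
    S = S' ∨ S = S'.flip a := by
  have hc : ∀ x, S'.circle x = S'.circle a ↔ S.circle x = S.circle a := by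
    rcases S with ⟨s, f⟩
    rcases S' with ⟨s', f'⟩
    obtain rfl : s = s' := hm
    exact fun _ => Iff.rfl
  have ha : ∀ (T : D.EnhState) (x : Dart C P), T.circle x = T.circle a →
      T.sign (T.circle x) = T.sign (T.circle a) := fun T x h => congrArg T.sign h
  by_cases h : S'.sign (S'.circle a) = S.sign (S.circle a)
  · refine Or.inl (ext_sign hm fun x => ?_)
    by_cases hx : S.circle x = S.circle a
    · rw [ha S x hx, ha S' x ((hc x).mpr hx), h]
    · exact (hs x hx).symm
  · refine Or.inr (ext_sign hm fun x => ?_)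
    rw [sign_flip]
    by_cases hx : S.circle x = S.circle a
    · rw [if_pos ((hc x).mpr hx), ha S x hx, ha S' x ((hc x).mpr hx)]
      exact Int.units_ne_iff_eq_neg.mp (Ne.symm h)
    · rw [if_neg (mt (hc x).mp hx), hs x hx]

theorem EnhState.sigma_flip [Fintype C] (S : D.EnhState) : (S.flip a).sigma = S.sigma := rfl

theorem EnhState.tau_flip [Finite C] [Finite P] (S : D.EnhState) :
    (S.flip a).tau = S.tau - 2 * S.sign (S.circle a) := by
  classical
  have : ∀ z : D.Circle S.marker, ((S.flip a).sign z : ℤ) =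
      S.sign z - if z = S.circle a then 2 * (S.sign (S.circle a) : ℤ) else 0 := by
    intro z
    by_cases hz : z = S.circle a
    · simp only [flip, hz, if_true, Units.val_neg]
      ring
    · simp [flip, hz]
  change ∑ z : D.Circle S.marker, ((S.flip a).sign z : ℤ) = _
  simp [this, tau]

variable [Fintype C] [Finite P]

theorem EnhState.Incident.flip {c : C} {S S' : D.EnhState} (h : Incident c S S')
    (ha : S'.sign (S'.circle a) = S.sign (S.circle a)) :
    Incident c (S.flip a) (S'.flip a) := by
  classical
  obtain ⟨hm, hσ, hw, hs⟩ := h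
  refine ⟨hm, hσ, ?_, fun x hx => ?_⟩
  · unfold weight at hw ⊢
    rw [tau_flip, tau_flip, sigma_flip, sigma_flip, ha]
    linarith
  · have hx' : ∀ k : Fin 4, S.circle (Sum.inl (c, k)) ≠ S.circle x := hx
    have := circle_eq_iff_of_not_touching (fun c' => (hm c').1) hx' a
    rw [sign_flip, sign_flip, hs x hx']
    rw [eq_comm, @eq_comm _ (S.circle a)] at this
    exact if_congr this rfl rfl

/-- Making the circle through `a` positive commutes with incidence. -/
theorem EnhState.incident_flip_iff (c : C) (S S' : D.EnhState) :
    S.sign (S.circle a) = -1 ∧ Incident c (S.flip a) S' ↔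
      S'.sign (S'.circle a) = 1 ∧ Incident c S (S'.flip a) := by
  constructor
  · rintro ⟨h1, h⟩
    have hm : ∀ c', (S.flip a).marker c' ≠ S'.marker c' → c' = c := fun c' => (h.1 c').1
    have h1' : (S.flip a).sign ((S.flip a).circle a) = 1 := by rw [sign_flip_self, h1, neg_neg]
    -- If the circle through `a` touches `c`, its sign in `S'` is forced; otherwise it is unchanged.
    have h2 : S'.sign (S'.circle a) = 1 := by
      by_cases hx : ∀ k : Fin 4, S'.circle (Sum.inl (c, k)) ≠ S'.circle a
      · rw [h.2.2.2 a (not_touching_of_not_touching (fun c' e => hm c' e.symm) hx), h1']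
      · obtain ⟨k, hk⟩ : ∃ k : Fin 4, (S.flip a).circle (Sum.inl (c, k)) = (S.flip a).circle a := by
          by_contra! hx'
          exact hx (not_touching_of_not_touching hm hx')
        push Not at hx
        obtain ⟨l, hl⟩ := hx
        rw [← hl]
        exact h.sign_eq_one (hk ▸ h1') l
    refine ⟨h2, ?_⟩
    have := h.flip (a := a) (by rw [h1', h2])
    rwa [flip_flip] at this
  · rintro ⟨h1, h⟩
    have hm : ∀ c', S.marker c' ≠ (S'.flip a).marker c' → c' = c := fun c' => (h.1 c').1
    have h1' : (S'.flip a).sign ((S'.flip a).circle a) = -1 := by rw [sign_flip_self, h1]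
    have h2 : S.sign (S.circle a) = -1 := by
      by_cases hx : ∀ k : Fin 4, S.circle (Sum.inl (c, k)) ≠ S.circle a
      · rw [← h.2.2.2 a hx, h1']
      · obtain ⟨k, hk⟩ :
            ∃ k : Fin 4, (S'.flip a).circle (Sum.inl (c, k)) = (S'.flip a).circle a := by
          by_contra! hx'
          exact hx (not_touching_of_not_touching (fun c' e => hm c' e.symm) hx')
        push Not at hx
        obtain ⟨l, hl⟩ := hx
        refine (Int.units_eq_one_or _).resolve_left fun h3 => ?_
        have := h.sign_eq_one (k := l) (by rw [hl, h3]) k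
        rw [hk, h1'] at this
        exact absurd this (by decide)
    refine ⟨h2, ?_⟩
    have := h.flip (a := a) (by rw [h1', h2])
    rwa [flip_flip] at this

end Flip

section Raise

variable {C P : Type*} (D : LinkDiagram C P) (R : Type*) [Ring R]

open scoped Classical in
/-- Multiplication by the nilpotent generator at the arc of `a`: a state whose circle through `a` is
negative is sent to the state in which that circle is positive, and the other states are sent
to `0`. -/
noncomputable def raise (a : Dart C P) : D.Chains R →ₗ[R] D.Chains R where
  toFun f S := if S.sign (S.circle a) = 1 then f (S.flip a) else 0
  map_add' f g := by
    ext S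
    by_cases h : S.sign (S.circle a) = 1 <;> simp [h]
  map_smul' r f := by
    ext S
    by_cases h : S.sign (S.circle a) = 1 <;> simp [h]

open scoped Classical in
theorem raise_apply (a : Dart C P) (f : D.Chains R) (S : D.EnhState) :
    D.raise R a f S = if S.sign (S.circle a) = 1 then f (S.flip a) else 0 :=
  rfl

theorem raise_mem_chains [Fintype C] [Finite P] (a : Dart C P) {i j j' : ℤ} (hj : j' = j + 4)
    {f : D.Chains R} (hf : f ∈ D.chains R i j) : D.raise R a f ∈ D.chains R i j' := by
  intro S hS
  rw [raise_apply]
  split_ifs with h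
  · refine hf _ fun h' => hS ?_
    rw [EnhState.weight, EnhState.tau_flip, EnhState.sigma_flip, h] at h'
    rw [EnhState.weight]
    push_cast at h'
    omega
  · rfl

end Raise

section Chains

variable {C P : Type*} [Fintype C] [LinearOrder C] [Finite P]
variable (D : LinkDiagram C P) (R : Type*) [Ring R]

open scoped Classical in
/-- The coefficient of `S'` in `d(S)`. -/
noncomputable def dCoeff (S S' : D.EnhState) : R :=
  ∑ c : C, if EnhState.Incident c S S' then (-1 : R) ^ S.negAfter c else 0

theorem d_apply (f : D.Chains R) (S' : D.EnhState) :
    D.d R f S' = ∑ S, f S * D.dCoeff R S S' := by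
  classical
  simp only [d, Fintype.linearCombination_apply, Finset.sum_apply, Pi.smul_apply, smul_eq_mul,
    dCoeff]
  refine Finset.sum_congr rfl fun S _ => ?_
  congr 1
  refine Finset.sum_congr rfl fun c _ => ?_
  rw [Finset.sum_eq_single S']
  · split_ifs <;> simp
  · intro T _ hT
    split_ifs
    · rw [Pi.single_eq_of_ne hT.symm]
    · rfl
  · simp

open scoped Classical in
/-- `d_raise` for matrix coefficients. The signs agree, as they only depend on the markers. -/
theorem dCoeff_flip (a : Dart C P) (S S' : D.EnhState) :
    (if S.sign (S.circle a) = -1 then D.dCoeff R (S.flip a) S' else 0) =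
      if S'.sign (S'.circle a) = 1 then D.dCoeff R S (S'.flip a) else 0 := by
  unfold dCoeff
  have (p : Prop) [Decidable p] (g : C → R) :
      (if p then ∑ c, g c else 0) = ∑ c, if p then g c else 0 := by split_ifs <;> simp
  rw [this, this]
  refine Finset.sum_congr rfl fun c _ => ?_
  rw [← ite_and, ← ite_and]
  simp only [EnhState.incident_flip_iff]
  rfl

/-- The action of the nilpotent generator is a chain map. -/
theorem d_raise (a : Dart C P) (f : D.Chains R) :
    D.d R (D.raise R a f) = D.raise R a (D.d R f) := by
  classical
  ext S'
  have hflip : Function.Involutive (EnhState.flip (D := D) a) := fun S => S.flip_flip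
  rw [raise_apply, d_apply, d_apply, ← hflip.toPerm.sum_comp _ _ (by simp)]
  have (p : Prop) [Decidable p] (g : D.EnhState → R) :
      (if p then ∑ S, g S else 0) = ∑ S, if p then g S else 0 := by split_ifs <;> simp
  rw [this]
  refine Finset.sum_congr rfl fun S _ => ?_
  rw [← mul_ite_zero, ← dCoeff_flip, mul_ite_zero, Function.Involutive.coe_toPerm, raise_apply,
    EnhState.flip_flip, EnhState.sign_flip_self, ite_zero_mul]
  simp only [neg_eq_iff_eq_neg]

end Chains

/-! ### Local states at the crossings of the Hopf diagram -/

section HopfState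

/-- The local states at the two crossings of the Hopf diagram: `(ε, some n)` has two markers `ε` and
a new circle with the sign `n`, and `(ε, none)` has the markers `ε` and `-ε`, and no new circle. -/
abbrev HopfState : Type := ℤˣ × Option ℤˣ

/-- The markers of a local state at the crossings of the Hopf diagram. -/
def hopfMarker : HopfState → Fin 2 → ℤˣ
  | (ε, some _) => fun _ => ε
  | (ε, none) => ![ε, -ε]

/-- The sign of the new circle, or `0` if there is none. -/
def newSign : HopfState → ℤ
  | (_, some n) => n
  | (_, none) => 0

/-- A label that tells apart the circles of the smoothed Hopf diagram. Positive markers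
separate the darts `0`, `1` of the first crossing and `2`, `3` of the second one from the others,
and negative markers separate the darts `0`, `3` of both crossings from the darts `1`, `2`. -/
def hopfSide : HopfState → Dart (Fin 2) Empty → Bool
  | (ε, some _), Sum.inl (c, k) =>
      if ε = 1 then xor (decide (2 ≤ k)) (decide (c = 1)) else decide (k = 1 ∨ k = 2)
  | (_, none), _ => false

/-- The dart opposite to `b` at the same crossing, which lies on the other circle of the smoothed
Hopf diagram if there are two of them. -/
def oppositeDart : Dart (Fin 2) Empty → Dart (Fin 2) Empty
  | Sum.inl (c, k) => Sum.inl (c, k + 2)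
  | Sum.inr (p, _) => p.elim

theorem hopfSide_glue (h : HopfState) (y : Dart (Fin 2) Empty) :
    hopfSide h (hopf.glue y) = hopfSide h y := by
  rcases y with ⟨c, k⟩ | ⟨p, -⟩
  · rcases h with ⟨ε, _ | n⟩
    · rfl
    · revert ε n c k
      decide
  · exact p.elim

theorem hopfSide_smoothing (h : HopfState) (y : Dart (Fin 2) Empty) :
    hopfSide h (smoothing (hopfMarker h) y) = hopfSide h y := by
  rcases y with ⟨c, k⟩ | ⟨p, -⟩
  · rcases h with ⟨ε, _ | n⟩
    · rfl
    · revert ε n c k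
      decide
  · exact p.elim

theorem hopfSide_oppositeDart (ε n : ℤˣ) (y : Dart (Fin 2) Empty) :
    hopfSide (ε, some n) (oppositeDart y) ≠ hopfSide (ε, some n) y := by
  rcases y with ⟨c, k⟩ | ⟨p, -⟩
  · revert ε n c k
    decide
  · exact p.elim

/-- The sign of the new circle, with the value `1` if there is none. -/
def newSignUnit (h : HopfState) : ℤˣ := h.2.getD 1

/-- A local state is determined by its markers and, if there is a new circle, by its sign; there is
a new circle if some dart `y` is not on the circle through `b`. -/
theorem hopfState_ext (b : Dart (Fin 2) Empty) {h h' : HopfState}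
    (hm : hopfMarker h = hopfMarker h')
    (hn : ∀ y, hopfSide h y ≠ hopfSide h b → hopfSide h' y ≠ hopfSide h' b →
      newSignUnit h = newSignUnit h') : h = h' := by
  have hne : ∀ ε : ℤˣ, -ε ≠ ε := by decide
  rcases h with ⟨ε, _ | n⟩ <;> rcases h' with ⟨ε', _ | n'⟩
  · exact congrArg (·, none) (congrFun hm 0 :)
  · have h0 : ε = ε' := congrFun hm 0
    have h1 : -ε = ε' := congrFun hm 1
    exact absurd (h1.trans h0.symm) (hne ε)
  · have h0 : ε = ε' := congrFun hm 0
    have h1 : ε = -ε' := congrFun hm 1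
    exact absurd (h1.symm.trans h0) (hne ε')
  · obtain rfl : ε = ε' := congrFun hm 0
    exact congrArg (fun m => (ε, some m)) (hn _ (hopfSide_oppositeDart _ _ _)
      (hopfSide_oppositeDart _ _ _))

/-- Every circle of the smoothed Hopf diagram touches both crossings. -/
theorem exists_hopfSide_eq (h : HopfState) (e : Fin 2) (y : Dart (Fin 2) Empty) :
    ∃ k : Fin 4, hopfSide h (Sum.inl (e, k)) = hopfSide h y := by
  rcases y with ⟨c, k⟩ | ⟨p, -⟩
  · rcases h with ⟨ε, _ | n⟩
    · exact ⟨0, rfl⟩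
    · revert ε n e c k
      decide
  · exact p.elim

/-- The ends of an arc of the Hopf diagram are joined by the rest of the circle through it. -/
theorem apply_hopf_glue_eq {α : Type*} (h : HopfState) (b : Dart (Fin 2) Empty)
    (g : Dart (Fin 2) Empty → α)
    (hg : ∀ y, y ≠ b → y ≠ hopf.glue b → g (hopf.glue y) = g y)
    (hs : ∀ y, g (smoothing (hopfMarker h) y) = g y) : g (hopf.glue b) = g b := by
  rcases b with ⟨cb, kb⟩ | ⟨p, -⟩
  swap
  · exact p.elim
  have g0 := fun k => hg (Sum.inl (0, k))
  have s0 := fun c k => hs (Sum.inl (c, k))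
  rcases h with ⟨ε, _ | n⟩ <;> rcases Int.units_eq_one_or ε with rfl | rfl <;>
    simp [hopf, Fin.forall_fin_succ, smoothing, turn, hopfMarker] at g0 s0 ⊢ <;>
    fin_cases cb <;> fin_cases kb <;> simp [Fin.rev] at g0 ⊢ <;> grind

/-- Cutting an arc of the Hopf diagram leaves its circles connected. -/
theorem eq_of_hopfSide_eq {α : Type*} (h : HopfState) (b : Dart (Fin 2) Empty)
    (g : Dart (Fin 2) Empty → α)
    (hg : ∀ y, y ≠ b → y ≠ hopf.glue b → g (hopf.glue y) = g y)
    (hs : ∀ y, g (smoothing (hopfMarker h) y) = g y) {y y' : Dart (Fin 2) Empty}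
    (hy : hopfSide h y = hopfSide h y') : g y = g y' := by
  have hb := apply_hopf_glue_eq h b g hg hs
  have hg' : ∀ y, g (hopf.glue y) = g y := by
    intro y
    by_cases h1 : y = b
    · rw [h1, hb]
    · by_cases h2 : y = hopf.glue b
      · rw [h2, hopf.glue_glue, hb]
      · exact hg y h1 h2
  have key : ∀ y, g y = g (if hopfSide h y then (if h.1 = 1 then Sum.inl (0, 2)
      else Sum.inl (0, 1)) else Sum.inl (0, 0)) := by
    rintro (⟨c, k⟩ | ⟨p, -⟩)
    swap
    · exact p.elim
    have g0 := fun k => hg' (Sum.inl (0, k))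
    have s0 := fun c k => hs (Sum.inl (c, k))
    rcases h with ⟨ε, _ | n⟩ <;> rcases Int.units_eq_one_or ε with rfl | rfl <;>
      simp [hopfSide, hopf, Fin.forall_fin_succ, smoothing, turn, hopfMarker, Fin.rev]
        at g0 s0 ⊢ <;>
      fin_cases c <;> fin_cases k <;> simp <;> grind
  rw [key y, key y', hy]

end HopfState

/-! ### The enhanced states of the connected sum -/

section Join

variable {C P : Type*}

/-- A dart of `D` as a dart of `D # D_h`. -/
abbrev leftDart (x : Dart C P) : Dart (C ⊕ₗ Fin 2) (P ⊕ Empty) :=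
  dartEquiv C P (Fin 2) Empty (Sum.inl x)

/-- A dart of `D_h` as a dart of `D # D_h`. -/
abbrev rightDart (C P : Type*) (y : Dart (Fin 2) Empty) : Dart (C ⊕ₗ Fin 2) (P ⊕ Empty) :=
  dartEquiv C P (Fin 2) Empty (Sum.inr y)

theorem forall_dart {p : Dart (C ⊕ₗ Fin 2) (P ⊕ Empty) → Prop} :
    (∀ x, p x) ↔ (∀ x, p (leftDart x)) ∧ ∀ y, p (rightDart C P y) := by
  rw [(dartEquiv C P (Fin 2) Empty).symm.forall_congr_left, Sum.forall]
  rfl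

theorem smoothing_leftDart (s : C ⊕ₗ Fin 2 → ℤˣ) (x : Dart C P) :
    smoothing s (leftDart x) = leftDart (smoothing (fun c => s (toLex (Sum.inl c))) x) := by
  rcases x with ⟨c, k⟩ | ⟨p, k⟩ <;> rfl

theorem smoothing_rightDart (s : C ⊕ₗ Fin 2 → ℤˣ) (y : Dart (Fin 2) Empty) :
    smoothing s (rightDart C P y) =
      rightDart C P (smoothing (fun e => s (toLex (Sum.inr e))) y) := by
  rcases y with ⟨c, k⟩ | ⟨p, k⟩ <;> rfl

variable {D : LinkDiagram C P} {a : Dart C P} {b : Dart (Fin 2) Empty}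

theorem hopfSum_glue_left_self : (D.hopfSum a b).glue (leftDart a) = rightDart C P b := by
  simp [connectedSum, sumGlue]

theorem hopfSum_glue_left_glue :
    (D.hopfSum a b).glue (leftDart (D.glue a)) = rightDart C P (hopf.glue b) := by
  simp [connectedSum, sumGlue, D.glue_ne]

theorem hopfSum_glue_left {x : Dart C P} (h1 : x ≠ a) (h2 : x ≠ D.glue a) :
    (D.hopfSum a b).glue (leftDart x) = leftDart (D.glue x) := by
  simp [connectedSum, sumGlue, h1, h2]

theorem hopfSum_glue_right {y : Dart (Fin 2) Empty} (h1 : y ≠ b) (h2 : y ≠ hopf.glue b) :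
    (D.hopfSum a b).glue (rightDart C P y) = rightDart C P (hopf.glue y) := by
  simp [connectedSum, sumGlue, h1, h2]

theorem hopfSum_glue_right_self : (D.hopfSum a b).glue (rightDart C P b) = leftDart a := by
  simp [connectedSum, sumGlue]

theorem hopfSum_glue_right_glue :
    (D.hopfSum a b).glue (rightDart C P (hopf.glue b)) = leftDart (D.glue a) := by
  simp [connectedSum, sumGlue, hopf.glue_ne]

section Circle

variable (T : (D.hopfSum a b).EnhState) {h : HopfState}

theorem circle_right_eq_of_hopfSide_eq (hT : ∀ e, T.marker (toLex (Sum.inr e)) = hopfMarker h e)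
    {y y' : Dart (Fin 2) Empty} (hy : hopfSide h y = hopfSide h y') :
    T.circle (rightDart C P y) = T.circle (rightDart C P y') := by
  refine eq_of_hopfSide_eq h b (fun y => T.circle (rightDart C P y)) (fun y h1 h2 => ?_)
    (fun y => ?_) hy
  · rw [← hopfSum_glue_right h1 h2, T.circle_glue]
  · rw [← funext hT, ← smoothing_rightDart, T.circle_smoothing]

theorem circle_right_self : T.circle (rightDart C P b) = T.circle (leftDart a) := by
  rw [← hopfSum_glue_left_self, T.circle_glue]

/-- The two ends of the arc at which `D` is cut are on one circle of `D # D_h`, through the Hopf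
diagram. -/
theorem circle_left_glue (hT : ∀ e, T.marker (toLex (Sum.inr e)) = hopfMarker h e)
    (x : Dart C P) : T.circle (leftDart (D.glue x)) = T.circle (leftDart x) := by
  have key : T.circle (leftDart (D.glue a)) = T.circle (leftDart a) := by
    rw [← circle_right_self, ← T.circle_glue (leftDart (D.glue a)), hopfSum_glue_left_glue]
    exact circle_right_eq_of_hopfSide_eq T hT (hopfSide_glue h b)
  by_cases h1 : x = a
  · rw [h1, key]
  by_cases h2 : x = D.glue a
  · rw [h2, D.glue_glue, key]
  · rw [← hopfSum_glue_left h1 h2, T.circle_glue]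

theorem circle_left_smoothing {s : C → ℤˣ} (hT : ∀ c, T.marker (toLex (Sum.inl c)) = s c)
    (x : Dart C P) : T.circle (leftDart (smoothing s x)) = T.circle (leftDart x) := by
  rw [← funext hT, ← smoothing_leftDart, T.circle_smoothing]

end Circle

/-- The function on the darts of `D # D_h` given by a function `f` on the darts of `D` and the
value `n` on the new circle; the darts of `D_h` on the circle through `b` get the value `f a`. If
`f` is constant on circles, so is the result. -/
def joinFun {α : Sort*} (a : Dart C P) (b : Dart (Fin 2) Empty) (h : HopfState)
    (f : Dart C P → α) (n : α) (x : Dart (C ⊕ₗ Fin 2) (P ⊕ Empty)) : α :=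
  Sum.elim f (fun y => if hopfSide h y = hopfSide h b then f a else n)
    ((dartEquiv C P (Fin 2) Empty).symm x)

section joinFun

variable {α : Sort*} {h : HopfState} {f : Dart C P → α} {n : α}

theorem joinFun_left (x : Dart C P) : joinFun a b h f n (leftDart x) = f x := by
  simp [joinFun]

theorem joinFun_right (y : Dart (Fin 2) Empty) : joinFun a b h f n (rightDart C P y) =
    if hopfSide h y = hopfSide h b then f a else n := by
  simp [joinFun]

theorem joinFun_glue (hf : ∀ x, f (D.glue x) = f x) (x : Dart (C ⊕ₗ Fin 2) (P ⊕ Empty)) :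
    joinFun a b h f n ((D.hopfSum a b).glue x) = joinFun a b h f n x := by
  revert x
  rw [forall_dart]
  constructor
  · intro x
    by_cases h1 : x = a
    · subst h1
      rw [hopfSum_glue_left_self, joinFun_left, joinFun_right, if_pos rfl]
    by_cases h2 : x = D.glue a
    · subst h2
      rw [hopfSum_glue_left_glue, joinFun_left, joinFun_right, if_pos (hopfSide_glue h b), hf]
    · rw [hopfSum_glue_left h1 h2, joinFun_left, joinFun_left, hf]
  · intro y
    by_cases h1 : y = b
    · subst h1
      rw [hopfSum_glue_right_self, joinFun_left, joinFun_right, if_pos rfl]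
    by_cases h2 : y = hopf.glue b
    · subst h2
      rw [hopfSum_glue_right_glue, joinFun_left, joinFun_right, if_pos (hopfSide_glue h b), hf]
    · rw [hopfSum_glue_right h1 h2, joinFun_right, joinFun_right, hopfSide_glue]

theorem joinFun_smoothing {t : C ⊕ₗ Fin 2 → ℤˣ}
    (ht : ∀ e, t (toLex (Sum.inr e)) = hopfMarker h e)
    (hf : ∀ x, f (smoothing (fun c => t (toLex (Sum.inl c))) x) = f x)
    (x : Dart (C ⊕ₗ Fin 2) (P ⊕ Empty)) :
    joinFun a b h f n (smoothing t x) = joinFun a b h f n x := by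
  revert x
  rw [forall_dart]
  constructor
  · intro x
    rw [smoothing_leftDart, joinFun_left, joinFun_left, hf]
  · intro y
    rw [smoothing_rightDart, joinFun_right, joinFun_right, funext ht, hopfSide_smoothing]

end joinFun

variable (a b) in
/-- The enhanced state of `D # D_h` that is `S` on `D` and `h` on the Hopf diagram. -/
def joinState (S : D.EnhState) (h : HopfState) : (D.hopfSum a b).EnhState where
  marker c := Sum.elim S.marker (hopfMarker h) (ofLex c)
  sign := Quot.lift (joinFun a b h (fun x => S.sign (S.circle x)) (newSignUnit h)) (by
    rintro x y (rfl | rfl)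
    · rw [joinFun_glue]
      intro x
      rw [S.circle_glue]
    · rw [joinFun_smoothing (fun e => rfl)]
      exact fun x => congrArg S.sign (S.circle_smoothing x))

section joinState

variable {S S' : D.EnhState} {h h' : HopfState}

theorem marker_joinState_inl (c : C) :
    (joinState a b S h).marker (toLex (Sum.inl c)) = S.marker c := rfl

theorem marker_joinState_inr (e : Fin 2) :
    (joinState a b S h).marker (toLex (Sum.inr e)) = hopfMarker h e := rfl

theorem sign_joinState_left (x : Dart C P) :
    (joinState a b S h).sign ((joinState a b S h).circle (leftDart x)) = S.sign (S.circle x) :=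
  joinFun_left x

theorem sign_joinState_right (y : Dart (Fin 2) Empty) :
    (joinState a b S h).sign ((joinState a b S h).circle (rightDart C P y)) =
      if hopfSide h y = hopfSide h b then S.sign (S.circle a) else newSignUnit h :=
  joinFun_right y

theorem circle_joinState_right {y : Dart (Fin 2) Empty} (hy : hopfSide h y = hopfSide h b) :
    (joinState a b S h).circle (rightDart C P y) = (joinState a b S h).circle (leftDart a) := by
  rw [circle_right_eq_of_hopfSide_eq _ marker_joinState_inr hy, circle_right_self]

theorem circle_joinState_left_iff (x x' : Dart C P) :
    (joinState a b S h).circle (leftDart x) = (joinState a b S h).circle (leftDart x') ↔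
      S.circle x = S.circle x' := by
  constructor
  · intro H
    have := (joinState a b S h).eq_of_circle_eq
      (joinFun a b h (fun y => S.circle y = S.circle x') False)
      (joinFun_glue fun y => by rw [S.circle_glue])
      (joinFun_smoothing (fun _ => rfl) fun y =>
        congrArg (fun z => z = S.circle x') (S.circle_smoothing y)) H
    rw [joinFun_left, joinFun_left] at this
    exact this.mpr rfl
  · exact fun H => S.eq_of_circle_eq (fun x => (joinState a b S h).circle (leftDart x))
      (circle_left_glue _ marker_joinState_inr) (circle_left_smoothing _ marker_joinState_inl) H

theorem circle_joinState_right_ne {y : Dart (Fin 2) Empty} (hy : hopfSide h y ≠ hopfSide h b)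
    (x : Dart C P) :
    (joinState a b S h).circle (rightDart C P y) ≠ (joinState a b S h).circle (leftDart x) := by
  intro H
  have := (joinState a b S h).eq_of_circle_eq
    (joinFun a b h (fun _ => True) False) (joinFun_glue fun y => rfl)
    (joinFun_smoothing (fun _ => rfl) fun y => rfl) H
  rw [joinFun_left, joinFun_right, if_neg hy] at this
  exact this.mpr trivial

/-- Every pair of markers, with any sign for the new circle if there is one, is a local state. -/
theorem exists_hopfMarker_eq (m : Fin 2 → ℤˣ) (n : ℤˣ) :
    ∃ h : HopfState, hopfMarker h = m ∧ ∀ y, hopfSide h y ≠ hopfSide h b → newSignUnit h = n := by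
  by_cases hm : m 0 = m 1
  · refine ⟨(m 0, some n), funext fun e => ?_, fun _ _ => rfl⟩
    fin_cases e
    exacts [rfl, hm]
  · refine ⟨(m 0, none), funext fun e => ?_, fun _ h => absurd rfl h⟩
    fin_cases e
    · rfl
    · exact (Int.units_ne_iff_eq_neg.mp (Ne.symm hm)).symm

theorem joinState_surjective (T : (D.hopfSum a b).EnhState) : ∃ S h, joinState a b S h = T := by
  obtain ⟨h, hm, hn⟩ := exists_hopfMarker_eq (b := b) (fun e => T.marker (toLex (Sum.inr e)))
    (T.sign (T.circle (rightDart C P (oppositeDart b))))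
  have hm' : ∀ e, T.marker (toLex (Sum.inr e)) = hopfMarker h e := fun e => (congrFun hm e).symm
  let S : D.EnhState :=
    { marker := fun c => T.marker (toLex (Sum.inl c))
      sign := Quot.lift (fun x => T.sign (T.circle (leftDart x))) (by
        rintro x y (rfl | rfl)
        · rw [circle_left_glue T hm']
        · rw [circle_left_smoothing T fun _ => rfl]) }
  refine ⟨S, h, EnhState.ext_sign ?_ (forall_dart.mpr ⟨fun x => ?_, fun y => ?_⟩)⟩
  · funext c
    rcases c with c | e
    exacts [rfl, (hm' e).symm]
  · exact sign_joinState_left x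
  · rw [sign_joinState_right]
    split_ifs with hy
    · rw [circle_right_eq_of_hopfSide_eq T hm' hy, circle_right_self]
      rfl
    · rw [hn y hy]
      rcases h with ⟨ε, _ | n⟩
      · exact absurd rfl hy
      · rw [circle_right_eq_of_hopfSide_eq T hm' (y := y) (y' := oppositeDart b)]
        exact (Bool.eq_not.mpr hy).trans (Bool.eq_not.mpr (hopfSide_oppositeDart ε n b)).symm

theorem joinState_injective (H : joinState a b S h = joinState a b S' h') : S = S' ∧ h = h' := by
  constructor
  · refine EnhState.ext_sign (funext fun c => ?_) fun x => ?_
    · rw [← marker_joinState_inl (a := a) (b := b) (h := h), H, marker_joinState_inl]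
    · rw [← sign_joinState_left (a := a) (b := b) (h := h), H, sign_joinState_left]
  · refine hopfState_ext b (funext fun e => ?_) fun y hy hy' => ?_
    · rw [← marker_joinState_inr (a := a) (b := b) (S := S), H, marker_joinState_inr]
    · have h1 := sign_joinState_right (a := a) (b := b) (S := S) (h := h) y
      have h2 := sign_joinState_right (a := a) (b := b) (S := S') (h := h') y
      rw [if_neg hy] at h1
      rw [if_neg hy'] at h2
      rw [← h1, H, h2]

theorem tau_joinState [Fintype C] [Finite P] :
    (joinState a b S h).tau = S.tau + newSign h := by
  let ψ : D.Circle S.marker ⊕ {n : ℤˣ // h.2 = some n} →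
      (D.hopfSum a b).Circle (joinState a b S h).marker :=
    Sum.elim (Quot.lift (fun x => (joinState a b S h).circle (leftDart x)) (by
        rintro x y (rfl | rfl)
        · rw [circle_left_glue _ marker_joinState_inr]
        · rw [circle_left_smoothing _ marker_joinState_inl]))
      fun _ => (joinState a b S h).circle (rightDart C P (oppositeDart b))
  have hopp : ∀ n, h.2 = some n → hopfSide h (oppositeDart b) ≠ hopfSide h b := by
    rcases h with ⟨ε, _ | n⟩
    · simp
    · exact fun _ _ => hopfSide_oppositeDart ε n b
  have hψ : Function.Bijective ψ := by
    constructor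
    · rintro (z | ⟨n, hn⟩) (z' | ⟨n', hn'⟩) H
      · induction z using Quot.ind with | mk x
        induction z' using Quot.ind with | mk x'
        exact congrArg Sum.inl ((circle_joinState_left_iff x x').mp H)
      · induction z using Quot.ind with | mk x
        exact absurd H.symm (circle_joinState_right_ne (hopp _ hn') x)
      · induction z' using Quot.ind with | mk x
        exact absurd H (circle_joinState_right_ne (hopp _ hn) x)
      · congr
        exact Option.some_injective _ (hn.symm.trans hn')
    · intro z
      induction z using Quot.ind with | mk x
      revert x
      refine forall_dart.mpr ⟨fun x => ⟨Sum.inl (S.circle x), rfl⟩, fun y => ?_⟩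
      by_cases hy : hopfSide h y = hopfSide h b
      · exact ⟨Sum.inl (S.circle a), (circle_joinState_right hy).symm⟩
      · rcases h with ⟨ε, _ | n⟩
        · exact absurd rfl hy
        · exact ⟨Sum.inr ⟨n, rfl⟩, circle_right_eq_of_hopfSide_eq _ marker_joinState_inr
            ((Bool.eq_not.mpr (hopp n rfl)).trans (Bool.eq_not.mpr hy).symm)⟩
  unfold EnhState.tau
  rw [← Fintype.sum_bijective ψ hψ (Sum.elim (fun z => (S.sign z : ℤ)) fun n => (n : ℤˣ)) _,
    Fintype.sum_sum_type]
  · congr 1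
    rcases h with ⟨ε, _ | n⟩
    · exact Fintype.sum_eq_zero _ fun ⟨n, hn⟩ => absurd hn (by simp)
    · let _ : Unique {m : ℤˣ // (ε, some n).2 = some m} :=
        ⟨⟨⟨n, rfl⟩⟩, fun ⟨m, hm⟩ => Subtype.ext (Option.some_injective _ hm).symm⟩
      rw [Fintype.sum_unique]
      rfl
  · rintro (z | ⟨n, hn⟩)
    · induction z using Quot.ind with | mk x
      exact congrArg Units.val (sign_joinState_left x).symm
    · refine congrArg Units.val (Eq.symm ((sign_joinState_right _).trans ?_))
      rw [if_neg (hopp n hn)]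
      exact congrArg (Option.getD · 1) hn

theorem sum_lex {M : Type*} [AddCommMonoid M] [Fintype C] (f : C ⊕ₗ Fin 2 → M) :
    ∑ c, f c = ∑ c, f (toLex (Sum.inl c)) + ∑ e, f (toLex (Sum.inr e)) := by
  rw [← Fintype.sum_sum_type (fun c => f (toLex c))]
  exact (Equiv.sum_comp toLex f).symm

theorem sigma_joinState [Fintype C] :
    (joinState a b S h).sigma = S.sigma + ∑ e, (hopfMarker h e : ℤ) := by
  rw [EnhState.sigma, sum_lex]
  rfl

end joinState

end Join

/-! ### Incidence in the connected sum -/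

section Incidence

variable {C P : Type*} {D : LinkDiagram C P} {a : Dart C P} {b : Dart (Fin 2) Empty}
variable [Fintype C] [Finite P] {S S' : D.EnhState} {h h' : HopfState}

theorem weight_joinState : (joinState a b S h).weight =
    S.weight + ∑ e, (hopfMarker h e : ℤ) + 2 * newSign h := by
  rw [EnhState.weight, EnhState.weight, sigma_joinState, tau_joinState]
  ring

/-- Incidence at a crossing of `D` is incidence in `D` with the same local state. -/
theorem incident_joinState_inl (c : C) :
    EnhState.Incident (toLex (Sum.inl c)) (joinState a b S h) (joinState a b S' h') ↔
      EnhState.Incident c S S' ∧ h = h' := by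
  constructor
  · rintro ⟨hm, hσ, hw, hs⟩
    have hh : h = h' := by
      refine hopfState_ext b (funext fun e => ?_) fun y hy hy' => ?_
      · by_contra he
        exact absurd ((hm (toLex (Sum.inr e))).mp he) (by simp)
      · have := hs (rightDart C P y) fun k H =>
          circle_joinState_right_ne hy (Sum.inl (c, k)) H.symm
        rwa [sign_joinState_right, sign_joinState_right, if_neg hy, if_neg hy', eq_comm] at this
    subst hh
    rw [sigma_joinState, sigma_joinState] at hσ
    rw [weight_joinState, weight_joinState] at hw
    refine ⟨⟨fun c' => ?_, by linarith, by linarith, fun x hx => ?_⟩, rfl⟩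
    · simpa [marker_joinState_inl] using hm (toLex (Sum.inl c'))
    · rw [← sign_joinState_left (a := a) (b := b) (h := h),
        ← sign_joinState_left (a := a) (b := b) (S := S) (h := h)]
      exact hs _ fun k H => hx k ((circle_joinState_left_iff _ _).mp H)
  · rintro ⟨⟨hm, hσ, hw, hs⟩, rfl⟩
    refine ⟨fun c' => ?_, ?_, ?_, forall_dart.mpr ⟨fun x hx => ?_, fun y hx => ?_⟩⟩
    · induction c' using toLex.forall_congr_right.mp with | _ c'
      rcases c' with c' | e
      · simpa [marker_joinState_inl] using hm c'
      · exact ⟨fun H => absurd rfl H, fun H => absurd H (by simp)⟩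
    · rw [sigma_joinState, sigma_joinState, hσ]
      ring
    · rw [weight_joinState, weight_joinState, hw]
    · rw [sign_joinState_left, sign_joinState_left]
      exact hs x fun k H => hx k ((circle_joinState_left_iff _ _).mpr H)
    · rw [sign_joinState_right, sign_joinState_right]
      split_ifs with hy
      · refine hs a fun k H => hx k ?_
        rw [circle_joinState_right hy]
        exact (circle_joinState_left_iff _ _).mpr H
      · rfl

/-- The local states `h` and `h'` have the same markers, except that the crossing `e` is positive
in `h` and negative in `h'`. -/
abbrev HopfStep (e : Fin 2) (h h' : HopfState) : Prop :=
  hopfMarker h e = 1 ∧ hopfMarker h' e = -1 ∧ ∀ e', e' ≠ e → hopfMarker h e' = hopfMarker h' e'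

/-- The local state before or after the step has no new circle, so `newSign` changes by `1`
or `-1`. -/
theorem newSign_ne_of_hopfStep : ∀ {e : Fin 2} {h h' : HopfState}, HopfStep e h h' →
    newSign h' ≠ newSign h + 3 := by
  decide

theorem hopfStep_iff {e : Fin 2} {h h' : HopfState} : HopfStep e h h' ↔
    (∀ e', hopfMarker h e' ≠ hopfMarker h' e' ↔ e' = e) ∧
      ∑ e, (hopfMarker h' e : ℤ) = ∑ e, (hopfMarker h e : ℤ) - 2 := by
  revert e h h'
  decide

/-- At a crossing of the Hopf diagram, a new circle is merged with or split off the circle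
through `a`. A merged new circle of sign `-` and a split off one of sign `+` leave the state of `D`
as it is; in the other cases the circle through `a` changes from `-` to `+`. -/
theorem incident_joinState_inr (e : Fin 2) :
    EnhState.Incident (toLex (Sum.inr e)) (joinState a b S h) (joinState a b S' h') ↔
      HopfStep e h h' ∧ (newSign h' = newSign h + 1 ∧ S = S' ∨
        newSign h' = newSign h - 1 ∧ S'.sign (S'.circle a) = 1 ∧ S = S'.flip a) := by
  -- The crossing `e` touches the circle through `a` and no other circle that meets `D`.
  have htouch : ∀ x, (∀ k : Fin 4, (joinState a b S h).circle (Sum.inl (toLex (Sum.inr e), k)) ≠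
      (joinState a b S h).circle (leftDart x)) ↔ S.circle x ≠ S.circle a := by
    intro x
    constructor
    · intro H hx
      obtain ⟨k, hk⟩ := exists_hopfSide_eq h e b
      exact H k ((circle_joinState_right hk).trans ((circle_joinState_left_iff _ _).mpr hx.symm))
    · intro hx k H
      by_cases hk : hopfSide h (Sum.inl (e, k)) = hopfSide h b
      · exact hx ((circle_joinState_left_iff _ _).mp
          ((circle_joinState_right hk).symm.trans H)).symm
      · exact circle_joinState_right_ne hk x H
  constructor
  · rintro ⟨hm, hσ, hw, hs⟩
    have hmS : S.marker = S'.marker := by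
      funext c
      by_contra H
      exact absurd ((hm (toLex (Sum.inl c))).mp H) (by simp)
    have hσS : S.sigma = S'.sigma := congrArg (fun s : C → ℤˣ => ∑ c, (s c : ℤ)) hmS
    rw [sigma_joinState, sigma_joinState] at hσ
    rw [weight_joinState, weight_joinState, EnhState.weight, EnhState.weight] at hw
    have hstep : HopfStep e h h' := hopfStep_iff.mpr
      ⟨fun e' => by simpa [marker_joinState_inr] using hm (toLex (Sum.inr e')), by linarith⟩
    refine ⟨hstep, ?_⟩
    rcases EnhState.eq_or_eq_flip hmS (a := a) fun x hx => by
      rw [← sign_joinState_left (a := a) (b := b) (h := h'),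
        ← sign_joinState_left (a := a) (b := b) (S := S) (h := h)]
      exact hs _ ((htouch x).mpr hx) with rfl | rfl
    · exact Or.inl ⟨by linarith, rfl⟩
    · have := newSign_ne_of_hopfStep hstep
      rw [EnhState.tau_flip] at hw
      rcases Int.units_eq_one_or (S'.sign (S'.circle a)) with h1 | h1
      · rw [h1, Units.val_one] at hw
        exact Or.inr ⟨by linarith, h1, rfl⟩
      · rw [h1, Units.val_neg, Units.val_one] at hw
        exact absurd (by linarith) this
  · rintro ⟨hstep, H⟩
    have hmS : S.marker = S'.marker := by
      rcases H with ⟨-, rfl⟩ | ⟨-, -, rfl⟩ <;> rfl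
    have hσS : S.sigma = S'.sigma := congrArg (fun s : C → ℤˣ => ∑ c, (s c : ℤ)) hmS
    obtain ⟨hm, hσ⟩ := hopfStep_iff.mp hstep
    refine ⟨fun c' => ?_, ?_, ?_, forall_dart.mpr ⟨fun x hx => ?_, fun y hx => ?_⟩⟩
    · induction c' using toLex.forall_congr_right.mp with | _ c'
      rcases c' with c' | e'
      · exact ⟨fun H => absurd (congrFun hmS c') H, fun H => absurd H (by simp)⟩
      · simpa [marker_joinState_inr] using hm e'
    · rw [sigma_joinState, sigma_joinState]
      linarith
    · rw [weight_joinState, weight_joinState, EnhState.weight, EnhState.weight]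
      rcases H with ⟨hn, rfl⟩ | ⟨hn, h1, rfl⟩
      · linarith
      · rw [EnhState.tau_flip, h1, Units.val_one]
        linarith
    · rw [sign_joinState_left, sign_joinState_left]
      have hx' := (htouch x).mp hx
      rcases H with ⟨-, rfl⟩ | ⟨-, -, rfl⟩
      · rfl
      · exact (if_neg hx').symm
    · obtain ⟨k, hk⟩ := exists_hopfSide_eq h e y
      exact absurd (circle_right_eq_of_hopfSide_eq _ marker_joinState_inr hk) (hx k)

end Incidence

/-! ### The differential of the connected sum -/

section Split

variable {C P : Type*} (D : LinkDiagram C P) (a : Dart C P) (b : Dart (Fin 2) Empty)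
  (R : Type*) [Ring R]

/-- The enhanced states of `D # D_h` are the pairs of an enhanced state of `D` and a local state. -/
noncomputable def joinEquiv : D.EnhState × HopfState ≃ (D.hopfSum a b).EnhState :=
  Equiv.ofBijective (fun p => joinState a b p.1 p.2)
    ⟨fun _ _ H => Prod.ext (joinState_injective H).1 (joinState_injective H).2,
      fun T => (joinState_surjective T).elim fun S ⟨h, H⟩ => ⟨(S, h), H⟩⟩

/-- The chains of `D # D_h` as families of chains of `D`, indexed by the local states. -/
noncomputable def splitChains : (D.hopfSum a b).Chains R ≃ₗ[R] (HopfState → D.Chains R) where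
  toFun F h S := F (joinState a b S h)
  invFun G T := G ((joinEquiv D a b).symm T).2 ((joinEquiv D a b).symm T).1
  map_add' _ _ := rfl
  map_smul' _ _ := rfl
  left_inv F := funext fun T => congrArg F ((joinEquiv D a b).apply_symm_apply T)
  right_inv G := by
    funext h S
    have := (joinEquiv D a b).symm_apply_apply (S, h)
    change G ((joinEquiv D a b).symm (joinEquiv D a b (S, h))).2
      ((joinEquiv D a b).symm (joinEquiv D a b (S, h))).1 = G h S
    rw [this]

theorem splitChains_apply (F : (D.hopfSum a b).Chains R) (h : HopfState) (S : D.EnhState) :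
    D.splitChains a b R F h S = F (joinState a b S h) :=
  rfl

end Split

section Differential

variable {C P : Type*} {D : LinkDiagram C P} {a : Dart C P} {b : Dart (Fin 2) Empty}

theorem sum_joinState [Fintype C] [Finite P] {M : Type*} [AddCommMonoid M]
    (f : (D.hopfSum a b).EnhState → M) :
    ∑ T, f T = ∑ h, ∑ S, f (joinState a b S h) := by
  rw [← (joinEquiv D a b).sum_comp, Fintype.sum_prod_type_right]
  rfl

variable [Fintype C] [LinearOrder C]

theorem negAfter_joinState_inl (S : D.EnhState) (h : HopfState) (c : C) :
    (joinState a b S h).negAfter (toLex (Sum.inl c)) =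
      S.negAfter c + (Finset.univ.filter fun e => hopfMarker h e = -1).card := by
  simp only [EnhState.negAfter, Finset.card_filter, sum_lex, marker_joinState_inl,
    marker_joinState_inr, Sum.Lex.inl_lt_inl_iff, Sum.Lex.inl_lt_inr, true_and]

theorem negAfter_joinState_inr (S : D.EnhState) (h : HopfState) (e : Fin 2) :
    (joinState a b S h).negAfter (toLex (Sum.inr e)) =
      if e = 0 ∧ hopfMarker h 1 = -1 then 1 else 0 := by
  simp only [EnhState.negAfter, Finset.card_filter, sum_lex, marker_joinState_inl,
    marker_joinState_inr, Sum.Lex.inr_lt_inr_iff, Sum.Lex.not_inr_lt_inl, false_and, if_false,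
    Finset.sum_const_zero, zero_add]
  revert h e
  decide

variable (D a b) [Finite P] (R : Type*) [Ring R]

/-- The differential of `D # D_h` in terms of that of `D` and of `raise`. The first sign counts the
negative markers at the Hopf crossings, all of which are bigger than those of `D`. -/
theorem splitChains_d_apply (F : (D.hopfSum a b).Chains R) (h' : HopfState) (S' : D.EnhState) :
    D.splitChains a b R ((D.hopfSum a b).d R F) h' S' =
      D.d R (D.splitChains a b R F h') S' *
        (-1) ^ (Finset.univ.filter fun e => hopfMarker h' e = -1).card +
      ∑ e, ∑ h, if HopfStep e h h' then
        ((if newSign h' = newSign h + 1 then D.splitChains a b R F h S' else 0) +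
          if newSign h' = newSign h - 1 then D.raise R a (D.splitChains a b R F h) S' else 0) *
          (-1) ^ (if e = 0 ∧ hopfMarker h 1 = -1 then 1 else 0)
        else 0 := by
  classical
  rw [splitChains_apply, d_apply, sum_joinState]
  simp only [dCoeff, sum_lex, mul_add, Finset.sum_add_distrib]
  congr 1
  · rw [Finset.sum_eq_single h', d_apply, Finset.sum_mul]
    · refine Finset.sum_congr rfl fun S _ => ?_
      rw [dCoeff, splitChains_apply, mul_assoc, Finset.sum_mul]
      congr 1
      refine Finset.sum_congr rfl fun c _ => ?_
      simp only [incident_joinState_inl, negAfter_joinState_inl, and_true, pow_add, ite_mul,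
        zero_mul]
    · intro h _ hh
      simp [incident_joinState_inl, hh]
    · simp
  · simp only [Finset.mul_sum]
    rw [Finset.sum_congr rfl fun h _ => Finset.sum_comm, Finset.sum_comm]
    refine Finset.sum_congr rfl fun e _ => Finset.sum_congr rfl fun h _ => ?_
    simp only [incident_joinState_inr, negAfter_joinState_inr, raise_apply, splitChains_apply]
    by_cases hs : HopfStep e h h'
    swap
    · rw [if_neg hs]
      exact Finset.sum_eq_zero fun S _ => by rw [if_neg fun H => hs H.1, mul_zero]
    have hand : ∀ q : Prop, HopfStep e h h' ∧ q ↔ q := fun q => and_iff_right hs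
    rw [if_pos hs]
    simp only [hand]
    by_cases h1 : newSign h' = newSign h + 1
    · have h2 : newSign h + 1 ≠ newSign h - 1 := by omega
      simp [h1, h2]
    · by_cases h2 : newSign h' = newSign h - 1
      · have h3 : newSign h - 1 ≠ newSign h + 1 := by omega
        by_cases h4 : S'.sign (S'.circle a) = 1 <;> simp [h2, h3, h4]
      · simp [h1, h2]

variable (F : (D.hopfSum a b).Chains R)

theorem splitChains_d_pos_some (n : ℤˣ) :
    D.splitChains a b R ((D.hopfSum a b).d R F) (1, some n) =
      D.d R (D.splitChains a b R F (1, some n)) := by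
  funext S
  rw [splitChains_d_apply]
  simp [HopfStep, hopfMarker]

theorem splitChains_d_pos_none :
    D.splitChains a b R ((D.hopfSum a b).d R F) (1, none) =
      -D.d R (D.splitChains a b R F (1, none)) + D.splitChains a b R F (1, some (-1)) +
        D.raise R a (D.splitChains a b R F (1, some 1)) := by
  funext S
  rw [splitChains_d_apply, show (Finset.univ.filter fun e => hopfMarker (1, none) e = -1).card = 1
    by decide]
  simp [Fintype.sum_prod_type, UnitsInt.univ, HopfStep, hopfMarker, newSign]
  abel

theorem splitChains_d_neg_none :
    D.splitChains a b R ((D.hopfSum a b).d R F) (-1, none) =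
      -D.d R (D.splitChains a b R F (-1, none)) + D.splitChains a b R F (1, some (-1)) +
        D.raise R a (D.splitChains a b R F (1, some 1)) := by
  funext S
  rw [splitChains_d_apply, show (Finset.univ.filter fun e => hopfMarker (-1, none) e = -1).card = 1
    by decide]
  simp [Fintype.sum_prod_type, UnitsInt.univ, HopfStep, hopfMarker, newSign]
  abel

theorem splitChains_d_neg_some_one :
    D.splitChains a b R ((D.hopfSum a b).d R F) (-1, some 1) =
      D.d R (D.splitChains a b R F (-1, some 1)) - D.splitChains a b R F (1, none) +
        D.splitChains a b R F (-1, none) := by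
  funext S
  rw [splitChains_d_apply, show
    (Finset.univ.filter fun e => hopfMarker (-1, some 1) e = -1).card = 2 by decide]
  simp [Fintype.sum_prod_type, UnitsInt.univ, HopfStep, hopfMarker, newSign]
  abel

theorem splitChains_d_neg_some_neg_one :
    D.splitChains a b R ((D.hopfSum a b).d R F) (-1, some (-1)) =
      D.d R (D.splitChains a b R F (-1, some (-1))) -
        D.raise R a (D.splitChains a b R F (1, none)) +
        D.raise R a (D.splitChains a b R F (-1, none)) := by
  funext S
  rw [splitChains_d_apply, show
    (Finset.univ.filter fun e => hopfMarker (-1, some (-1)) e = -1).card = 2 by decide]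
  simp [Fintype.sum_prod_type, UnitsInt.univ, HopfStep, hopfMarker, newSign]
  abel

end Differential

/-! ### Chain maps and the chain homotopy -/

section Components

variable {C P : Type*} (D : LinkDiagram C P) (a : Dart C P) (b : Dart (Fin 2) Empty)

variable {D a b} in
theorem hopfExtends_joinState_iff {ε : ℤˣ} {S S' : D.EnhState} {h : HopfState} :
    HopfExtends ε S (joinState a b S' h) ↔ S = S' ∧ h = (ε, some ε) := by
  constructor
  · rintro ⟨h1, h2, h3, h4⟩
    refine ⟨EnhState.ext_sign (funext fun c => (h1 c).symm) fun x => ?_,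
      hopfState_ext b (funext h2) fun y hy _ => ?_⟩
    · rw [← h3 x, sign_joinState_left]
    · have := h4 _ fun x H => circle_joinState_right_ne hy x H.symm
      rwa [sign_joinState_right, if_neg hy] at this
  · rintro ⟨rfl, rfl⟩
    refine ⟨fun _ => rfl, fun _ => rfl, sign_joinState_left, fun z => ?_⟩
    induction z using Quot.ind with | mk y
    revert y
    refine forall_dart.mpr ⟨fun x H => absurd rfl (H x), fun y H => ?_⟩
    refine (sign_joinState_right y).trans (if_neg fun hy => H a ?_)
    exact (circle_joinState_right hy).symm

variable (R : Type*) [Ring R]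

/-- The section of `β_h`: with both markers positive, the new circle gets the sign `+`, and the
multiple of the sign `-` that makes the sum vanish when the new circle is merged with the circle
through `a` is subtracted. -/
noncomputable def betaSection : D.Chains R →ₗ[R] (D.hopfSum a b).Chains R :=
  (D.splitChains a b R).symm.toLinearMap ∘ₗ
    (LinearMap.single R (fun _ : HopfState => D.Chains R) (1, some 1) -
      LinearMap.single R (fun _ : HopfState => D.Chains R) (1, some (-1)) ∘ₗ D.raise R a)

/-- The retraction of `α_h`: the chains with both markers negative modulo those obtained by
splitting the new circle off the circle through `a`. -/
noncomputable def alphaRetraction : (D.hopfSum a b).Chains R →ₗ[R] D.Chains R :=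
  (LinearMap.proj (R := R) (φ := fun _ : HopfState => D.Chains R) (-1, some (-1)) -
      D.raise R a ∘ₗ
        LinearMap.proj (R := R) (φ := fun _ : HopfState => D.Chains R) (-1, some 1)) ∘ₗ
    (D.splitChains a b R).toLinearMap

/-- The chain homotopy between the identity and the sum of the projections of the two summands: it
inverts the components of the differential at the first Hopf crossing that split off a positive new
circle (with coefficient `-1`) and that merge a negative one (with coefficient `1`). -/
noncomputable def hopfHomotopy : (D.hopfSum a b).Chains R →ₗ[R] (D.hopfSum a b).Chains R :=
  (D.splitChains a b R).symm.toLinearMap ∘ₗ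
    (LinearMap.single R (fun _ : HopfState => D.Chains R) (1, some (-1)) ∘ₗ
        LinearMap.proj (R := R) (φ := fun _ : HopfState => D.Chains R) (-1, none) -
      LinearMap.single R (fun _ : HopfState => D.Chains R) (1, none) ∘ₗ
        LinearMap.proj (R := R) (φ := fun _ : HopfState => D.Chains R) (-1, some 1)) ∘ₗ
    (D.splitChains a b R).toLinearMap

theorem splitChains_betaSection (f : D.Chains R) : D.splitChains a b R (D.betaSection a b R f) =
    Pi.single (1, some 1) f - Pi.single (1, some (-1)) (D.raise R a f) := by
  simp [betaSection]

theorem alphaRetraction_apply (F : (D.hopfSum a b).Chains R) : D.alphaRetraction a b R F =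
    D.splitChains a b R F (-1, some (-1)) -
      D.raise R a (D.splitChains a b R F (-1, some 1)) := by
  simp [alphaRetraction]

theorem splitChains_hopfHomotopy (F : (D.hopfSum a b).Chains R) :
    D.splitChains a b R (D.hopfHomotopy a b R F) =
      Pi.single (1, some (-1)) (D.splitChains a b R F (-1, none)) -
        Pi.single (1, none) (D.splitChains a b R F (-1, some 1)) := by
  simp [hopfHomotopy]

variable {D a b R} in
/-- Two chains of `D # D_h` are equal if their six components are equal. -/
theorem splitChains_ext {F G : (D.hopfSum a b).Chains R}
    (h1 : D.splitChains a b R F (1, some 1) = D.splitChains a b R G (1, some 1))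
    (h2 : D.splitChains a b R F (1, some (-1)) = D.splitChains a b R G (1, some (-1)))
    (h3 : D.splitChains a b R F (1, none) = D.splitChains a b R G (1, none))
    (h4 : D.splitChains a b R F (-1, none) = D.splitChains a b R G (-1, none))
    (h5 : D.splitChains a b R F (-1, some 1) = D.splitChains a b R G (-1, some 1))
    (h6 : D.splitChains a b R F (-1, some (-1)) = D.splitChains a b R G (-1, some (-1))) :
    F = G := by
  refine (D.splitChains a b R).injective (funext fun ⟨ε, o⟩ => ?_)
  rcases Int.units_eq_one_or ε with rfl | rfl <;> rcases o with _ | n <;>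
    [skip; rcases Int.units_eq_one_or n with rfl | rfl; skip;
      rcases Int.units_eq_one_or n with rfl | rfl] <;> assumption

theorem alphaRetraction_betaSection (f : D.Chains R) :
    D.alphaRetraction a b R (D.betaSection a b R f) = 0 := by
  simp [alphaRetraction_apply, splitChains_betaSection]

end Components

section Maps

variable {C P : Type*} [Fintype C] [Finite P] (D : LinkDiagram C P) (a : Dart C P)
  (b : Dart (Fin 2) Empty) (R : Type*) [Ring R]

theorem splitChains_alphaH (f : D.Chains R) :
    D.splitChains a b R (D.alphaH a b R f) = Pi.single (-1, some (-1)) f := by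
  classical
  funext h S'
  have hsum (S : D.EnhState) : (∑ T : (D.hopfSum a b).EnhState,
      if HopfExtends (-1) S T then Pi.single T (1 : R) else 0) (joinState a b S' h) =
      if S = S' ∧ h = (-1, some (-1)) then 1 else 0 := by
    rw [Finset.sum_apply, Finset.sum_eq_single (joinState a b S' h)]
    · simp only [hopfExtends_joinState_iff]
      split_ifs <;> simp
    · intro T _ hT
      split_ifs
      · exact Pi.single_eq_of_ne hT.symm _
      · rfl
    · simp
  rw [splitChains_apply, alphaH, Fintype.linearCombination_apply, Finset.sum_apply]
  simp only [Pi.smul_apply, hsum, smul_eq_mul, mul_ite, mul_one, mul_zero]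
  by_cases hh : h = (-1, some (-1))
  · subst hh
    simp
  · simp [hh]

theorem betaH_apply (F : (D.hopfSum a b).Chains R) :
    D.betaH a b R F = D.splitChains a b R F (1, some 1) := by
  classical
  funext S
  have hsum (S' : D.EnhState) (h : HopfState) : (∑ T : D.EnhState,
      if HopfExtends 1 T (joinState a b S' h) then Pi.single T (1 : R) else 0) S =
      if S = S' ∧ h = (1, some 1) then 1 else 0 := by
    rw [Finset.sum_apply, Finset.sum_eq_single S]
    · simp only [hopfExtends_joinState_iff]
      split_ifs <;> simp
    · intro T _ hT
      split_ifs
      · exact Pi.single_eq_of_ne hT.symm _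
      · rfl
    · simp
  rw [splitChains_apply, betaH, Fintype.linearCombination_apply, Finset.sum_apply, sum_joinState,
    Finset.sum_eq_single (1, some 1)]
  · simp only [Pi.smul_apply, hsum, smul_eq_mul, mul_ite, mul_one, mul_zero]
    simp
  · intro h _ hh
    simp only [Pi.smul_apply, hsum, smul_eq_mul, mul_ite, mul_one, mul_zero]
    simp [hh]
  · simp

theorem alphaRetraction_alphaH (f : D.Chains R) :
    D.alphaRetraction a b R (D.alphaH a b R f) = f := by
  simp [alphaRetraction_apply, splitChains_alphaH]

theorem betaH_alphaH (f : D.Chains R) : D.betaH a b R (D.alphaH a b R f) = 0 := by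
  simp [betaH_apply, splitChains_alphaH]

theorem betaH_betaSection (f : D.Chains R) : D.betaH a b R (D.betaSection a b R f) = f := by
  simp [betaH_apply, splitChains_betaSection]

variable [LinearOrder C]

theorem d_alphaH (f : D.Chains R) :
    (D.hopfSum a b).d R (D.alphaH a b R f) = D.alphaH a b R (D.d R f) := by
  apply splitChains_ext <;>
    simp [splitChains_alphaH, splitChains_d_pos_some, splitChains_d_pos_none,
      splitChains_d_neg_none, splitChains_d_neg_some_one, splitChains_d_neg_some_neg_one]

theorem d_betaH (F : (D.hopfSum a b).Chains R) :
    D.d R (D.betaH a b R F) = D.betaH a b R ((D.hopfSum a b).d R F) := by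
  rw [betaH_apply, betaH_apply, splitChains_d_pos_some]

theorem d_betaSection (f : D.Chains R) :
    (D.hopfSum a b).d R (D.betaSection a b R f) = D.betaSection a b R (D.d R f) := by
  apply splitChains_ext <;>
    simp [splitChains_betaSection, splitChains_d_pos_some, splitChains_d_pos_none, d_raise,
      splitChains_d_neg_none, splitChains_d_neg_some_one, splitChains_d_neg_some_neg_one]

theorem d_alphaRetraction (F : (D.hopfSum a b).Chains R) :
    D.d R (D.alphaRetraction a b R F) = D.alphaRetraction a b R ((D.hopfSum a b).d R F) := by
  rw [alphaRetraction_apply, alphaRetraction_apply, splitChains_d_neg_some_one,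
    splitChains_d_neg_some_neg_one]
  simp only [map_sub, map_add, d_raise]
  abel

/-- The identity of the chains of `D # D_h` is homotopic to the sum of the two projections. -/
theorem hopfHomotopy_spec (F : (D.hopfSum a b).Chains R) :
    D.alphaH a b R (D.alphaRetraction a b R F) + D.betaSection a b R (D.betaH a b R F) +
      (D.hopfSum a b).d R (D.hopfHomotopy a b R F) +
      D.hopfHomotopy a b R ((D.hopfSum a b).d R F) = F := by
  apply splitChains_ext <;>
    simp [splitChains_alphaH, splitChains_betaSection, splitChains_hopfHomotopy,
      alphaRetraction_apply, betaH_apply, splitChains_d_pos_some, splitChains_d_pos_none,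
      splitChains_d_neg_none, splitChains_d_neg_some_one, splitChains_d_neg_some_neg_one]
  abel

end Maps

/-! ### Degrees -/

section Degree

variable {C P : Type*} [Fintype C] [Finite P] {D : LinkDiagram C P} {a : Dart C P}
  {b : Dart (Fin 2) Empty} {R : Type*} [Ring R] {i j i' j' : ℤ}

theorem splitChains_mem_chains {F : (D.hopfSum a b).Chains R}
    (hF : F ∈ (D.hopfSum a b).chains R i j) (h : HopfState)
    (hi : i' + ∑ e, (hopfMarker h e : ℤ) = i)
    (hj : j' + ∑ e, (hopfMarker h e : ℤ) + 2 * newSign h = j) :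
    D.splitChains a b R F h ∈ D.chains R i' j' := by
  intro S hS
  refine hF _ fun H => hS ?_
  rw [sigma_joinState, weight_joinState] at H
  constructor <;> linarith [H.1, H.2]

theorem splitChains_symm_single_mem_chains {f : D.Chains R} (hf : f ∈ D.chains R i' j')
    (h : HopfState) (hi : i' + ∑ e, (hopfMarker h e : ℤ) = i)
    (hj : j' + ∑ e, (hopfMarker h e : ℤ) + 2 * newSign h = j) :
    (D.splitChains a b R).symm (Pi.single h f) ∈ (D.hopfSum a b).chains R i j := by
  intro T hT
  obtain ⟨S, h', rfl⟩ := joinState_surjective T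
  change D.splitChains a b R ((D.splitChains a b R).symm (Pi.single h f)) h' S = 0
  rw [LinearEquiv.apply_symm_apply]
  by_cases hh : h' = h
  · subst hh
    rw [Pi.single_eq_same]
    refine hf _ fun H => hT ?_
    rw [sigma_joinState, weight_joinState]
    constructor <;> linarith [H.1, H.2]
  · rw [Pi.single_eq_of_ne hh]
    rfl

theorem alphaH_mem_chains {f : D.Chains R} (hf : f ∈ D.chains R (i + 2) (j + 4)) :
    D.alphaH a b R f ∈ (D.hopfSum a b).chains R i j := by
  rw [← (D.splitChains a b R).symm_apply_apply (D.alphaH a b R f), splitChains_alphaH]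
  apply splitChains_symm_single_mem_chains hf <;> simp [hopfMarker, newSign]
  ring

theorem betaH_mem_chains {F : (D.hopfSum a b).Chains R}
    (hF : F ∈ (D.hopfSum a b).chains R i j) :
    D.betaH a b R F ∈ D.chains R (i - 2) (j - 4) := by
  rw [betaH_apply]
  apply splitChains_mem_chains hF <;> simp [hopfMarker, newSign]
  ring

theorem betaSection_mem_chains {f : D.Chains R} (hf : f ∈ D.chains R (i - 2) (j - 4)) :
    D.betaSection a b R f ∈ (D.hopfSum a b).chains R i j := by
  rw [← (D.splitChains a b R).symm_apply_apply (D.betaSection a b R f), splitChains_betaSection,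
    map_sub]
  refine sub_mem ?_ ?_
  · apply splitChains_symm_single_mem_chains hf <;> simp [hopfMarker, newSign]
    ring
  · apply splitChains_symm_single_mem_chains (D.raise_mem_chains R a (j' := j) (by ring) hf) <;>
      simp [hopfMarker, newSign]

theorem alphaRetraction_mem_chains {F : (D.hopfSum a b).Chains R}
    (hF : F ∈ (D.hopfSum a b).chains R i j) :
    D.alphaRetraction a b R F ∈ D.chains R (i + 2) (j + 4) := by
  rw [alphaRetraction_apply]
  refine sub_mem ?_ (D.raise_mem_chains R a rfl ?_) <;>
    apply splitChains_mem_chains hF <;> simp [hopfMarker, newSign]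
  ring

theorem hopfHomotopy_mem_chains {F : (D.hopfSum a b).Chains R}
    (hF : F ∈ (D.hopfSum a b).chains R i j) :
    D.hopfHomotopy a b R F ∈ (D.hopfSum a b).chains R (i + 2) j := by
  rw [← (D.splitChains a b R).symm_apply_apply (D.hopfHomotopy a b R F),
    splitChains_hopfHomotopy, map_sub]
  refine sub_mem ?_ ?_
  · apply splitChains_symm_single_mem_chains
      (splitChains_mem_chains hF (i' := i) (j' := j) _ _ _) <;> simp [hopfMarker, newSign]
  · apply splitChains_symm_single_mem_chains
      (splitChains_mem_chains hF (i' := i + 2) (j' := j) _ _ _) <;> simp [hopfMarker, newSign]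

end Degree

/-! ### Induced maps on homology -/

section HomologyMap

variable {C₁ P₁ C₂ P₂ : Type*} [Fintype C₁] [LinearOrder C₁] [Finite P₁] [Fintype C₂]
  [LinearOrder C₂] [Finite P₂] {D₁ : LinkDiagram C₁ P₁} {D₂ : LinkDiagram C₂ P₂} {R : Type*}
  [Ring R] {i j i' j' : ℤ} (f : D₁.Chains R →ₗ[R] D₂.Chains R)

theorem map_mem_cycles (hd : ∀ x, D₂.d R (f x) = f (D₁.d R x))
    (hf : ∀ x ∈ D₁.chains R i j, f x ∈ D₂.chains R i' j')
    {x : D₁.Chains R} (hx : x ∈ D₁.cycles R i j) : f x ∈ D₂.cycles R i' j' := by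
  refine ⟨?_, hf x hx.2⟩
  rw [SetLike.mem_coe, LinearMap.mem_ker, hd, LinearMap.mem_ker.mp hx.1, map_zero]

variable (hd : ∀ x, D₂.d R (f x) = f (D₁.d R x))

/-- The map on homology induced by a map of bigraded chains that commutes with the differentials. -/
noncomputable def homologyMap (hf : ∀ x ∈ D₁.chains R i j, f x ∈ D₂.chains R i' j')
    (hf' : ∀ x ∈ D₁.chains R (i + 2) j, f x ∈ D₂.chains R (i' + 2) j') :
    D₁.Homology R i j →ₗ[R] D₂.Homology R i' j' :=
  Submodule.mapQ _ _ (f.restrict fun _ hx => map_mem_cycles f hd hf hx) (by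
    rintro ⟨x, hx⟩ ⟨y, hy, rfl⟩
    exact ⟨f y, hf' y hy, hd y⟩)

theorem homologyClass_surjective : Function.Surjective (D₁.homologyClass R i j) :=
  Submodule.mkQ_surjective _

theorem homologyClass_eq_iff {z w : D₁.cycles R i j} :
    D₁.homologyClass R i j z = D₁.homologyClass R i j w ↔
      (z : D₁.Chains R) - w ∈ D₁.boundaries R i j :=
  Submodule.Quotient.eq _

end HomologyMap

end LinkDiagram

theorem theorem6p2 {C P : Type*} [Fintype C] [LinearOrder C] [Finite P]
    (D : LinkDiagram C P) (hD : D.IsPlanar)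
    (a : Dart C P) (b : Dart (Fin 2) Empty)
    (R : Type*) [Ring R] (i j : ℤ) :
    ∃ (α : D.Homology R (i + 2) (j + 4) →ₗ[R] (D.hopfSum a b).Homology R i j)
      (β : (D.hopfSum a b).Homology R i j →ₗ[R] D.Homology R (i - 2) (j - 4)),
      -- `α` and `β` are induced by the chain level maps `α_h` and `β_h`
      (∀ z : D.cycles R (i + 2) (j + 4), ∃ w : (D.hopfSum a b).cycles R i j,
        (w : (D.hopfSum a b).Chains R) = D.alphaH a b R z ∧
        α (D.homologyClass R (i + 2) (j + 4) z) = (D.hopfSum a b).homologyClass R i j w) ∧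
      (∀ w : (D.hopfSum a b).cycles R i j, ∃ z : D.cycles R (i - 2) (j - 4),
        (z : D.Chains R) = D.betaH a b R w ∧
        β ((D.hopfSum a b).homologyClass R i j w) = D.homologyClass R (i - 2) (j - 4) z) ∧
      -- the short exact sequence
      Function.Injective α ∧ Function.Exact α β ∧ Function.Surjective β ∧
      -- the sequence splits
      ∃ φ : (D.hopfSum a b).Homology R i j ≃ₗ[R]
          D.Homology R (i + 2) (j + 4) × D.Homology R (i - 2) (j - 4),
        (∀ x, φ (α x) = (x, 0)) ∧ ∀ y, (φ y).2 = β y := by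
  -- Boundaries in bidegree `(i - 2, j - 4)` come from `σ = i - 2 + 2`, and the lemmas on degrees
  -- give `i + 2 - 2`.
  have e (k : ℤ) : k - 2 + 2 = k + 2 - 2 := by ring
  let α : D.Homology R (i + 2) (j + 4) →ₗ[R] (D.hopfSum a b).Homology R i j :=
    LinkDiagram.homologyMap (D.alphaH a b R) (D.d_alphaH a b R)
      (fun _ => LinkDiagram.alphaH_mem_chains) (fun _ => LinkDiagram.alphaH_mem_chains)
  let β : (D.hopfSum a b).Homology R i j →ₗ[R] D.Homology R (i - 2) (j - 4) :=
    LinkDiagram.homologyMap (D.betaH a b R) (D.d_betaH a b R)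
      (fun _ => LinkDiagram.betaH_mem_chains)
      (fun x hx => by rw [e]; exact LinkDiagram.betaH_mem_chains hx)
  let ρ : (D.hopfSum a b).Homology R i j →ₗ[R] D.Homology R (i + 2) (j + 4) :=
    LinkDiagram.homologyMap (D.alphaRetraction a b R) (D.d_alphaRetraction a b R)
      (fun _ => LinkDiagram.alphaRetraction_mem_chains)
      (fun _ => LinkDiagram.alphaRetraction_mem_chains)
  let γ : D.Homology R (i - 2) (j - 4) →ₗ[R] (D.hopfSum a b).Homology R i j :=
    LinkDiagram.homologyMap (D.betaSection a b R) (D.d_betaSection a b R)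
      (fun _ => LinkDiagram.betaSection_mem_chains)
      (fun x hx => by rw [e] at hx; exact LinkDiagram.betaSection_mem_chains hx)
  have hρα : ∀ x, ρ (α x) = x := by
    intro x
    obtain ⟨z, rfl⟩ := LinkDiagram.homologyClass_surjective x
    exact congrArg (D.homologyClass R _ _) (Subtype.ext (D.alphaRetraction_alphaH a b R z))
  have hβγ : ∀ x, β (γ x) = x := by
    intro x
    obtain ⟨z, rfl⟩ := LinkDiagram.homologyClass_surjective x
    exact congrArg (D.homologyClass R _ _) (Subtype.ext (D.betaH_betaSection a b R z))
  have hβα : ∀ x, β (α x) = 0 := by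
    intro x
    obtain ⟨z, rfl⟩ := LinkDiagram.homologyClass_surjective x
    exact congrArg (D.homologyClass R _ _) (Subtype.ext (D.betaH_alphaH a b R z))
  have hργ : ∀ x, ρ (γ x) = 0 := by
    intro x
    obtain ⟨z, rfl⟩ := LinkDiagram.homologyClass_surjective x
    exact congrArg (D.homologyClass R _ _) (Subtype.ext (D.alphaRetraction_betaSection a b R z))
  have hadd : ∀ y, α (ρ y) + γ (β y) = y := by
    intro y
    obtain ⟨w, rfl⟩ := LinkDiagram.homologyClass_surjective y
    -- On a cycle, the homotopy formula has only the boundary of the homotopy as a correction.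
    refine Eq.symm (LinkDiagram.homologyClass_eq_iff
      (w := ⟨D.alphaH a b R (D.alphaRetraction a b R w) +
        D.betaSection a b R (D.betaH a b R w), _⟩) |>.mpr ?_)
    refine ⟨D.hopfHomotopy a b R w, LinkDiagram.hopfHomotopy_mem_chains w.2.2, ?_⟩
    have h := D.hopfHomotopy_spec a b R w
    rw [LinearMap.mem_ker.mp w.2.1, map_zero, add_zero] at h
    exact eq_sub_of_add_eq' h
  let φ : (D.hopfSum a b).Homology R i j ≃ₗ[R]
      D.Homology R (i + 2) (j + 4) × D.Homology R (i - 2) (j - 4) :=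
    LinearEquiv.ofLinearMap (ρ.prod β) (α.coprod γ)
      (LinearMap.ext fun ⟨x, y⟩ => by simp [hρα, hβγ, hβα, hργ])
      (LinearMap.ext fun y => by simp [hadd])
  refine ⟨α, β, fun z => ⟨_, rfl, rfl⟩, fun w => ⟨_, rfl, rfl⟩,
    Function.LeftInverse.injective hρα, fun y => ⟨fun hy => ⟨ρ y, ?_⟩, ?_⟩,
    Function.RightInverse.surjective hβγ, φ, fun x => ?_, fun y => rfl⟩
  · simpa [hy] using hadd y
  · rintro ⟨x, rfl⟩
    exact hβα x
  · exact Prod.ext (hρα x) (hβα x)
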